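/- Let $G=(V,E)$ be a finite connected undirected graph with edge weights $w:E\to(0,\infty)$, let $d_G$ be its weighted shortest-path distance, and for a set of edges $F$ put $W(F)=\sum_{e\in F}w(e)$. For a non-empty set of terminals $T\subseteq V$ and $t\ge 1$, a subsetwise $t$-spanner of $G$ over $T$ is a subgraph $G'$ of $G$ that contains $T$ and satisfies $d_{G'}(u,v)\le t\,d_G(u,v)$ for all $u,v\in T$ (for $T=V$, a $t$-spanner). Let $\mathrm{OPT}$ be the minimum of $W(E(G'))$ over all such $G'$, and let $W(\mathrm{ST}(G,T))$ be the minimum of $W(E(H))$ over all subtrees $H$ of $G$ that contain $T$. The metric closure $\tilde G$ of $G$ over $T$ is the complete graph on $T$ in which the edge $\{u,v\}$ has weight $d_G(u,v)$. The metric closure construction forms $\tilde G$, computes a $t$-spanner $\tilde G'$ of $\tilde G$ with a spanner subroutine, and returns the subgraph $G'$ of $G$ whose edge set $E'$ is the union, over the edges $\{u,v\}$ of $\tilde G'$, of the edge sets of shortest $u$-$v$ paths of $G$ (one arbitrary shortest path for each edge). Theorem. There is a deterministic spanner subroutine (a fixed real-RAM program, whose input is $|T|$, $k$, $\varepsilon$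 and the matrix of the distances $d_G(u,v)$, $u,v\in T$, for an arbitrary numbering of $T$, and whose output is the list of edges of $\tilde G'$) with the following property. For every integer $k\ge 1$ and every real $\varepsilon>0$ there is a constant $C>0$ depending only on $k$ and $\varepsilon$ such that, for all $G$, $w$ and $T$ as above and $t=(2k-1)(1+\varepsilon)$, the subroutine, applied to the metric closure $\tilde G$, halts after at most $C\,|T|^{2+1/k}$ steps with a $t$-spanner $\tilde G'$ of $\tilde G$, and the metric closure construction then yields a subsetwise $(2k-1)(1+\varepsilon)$-spanner $G'$ of $G$ over $T$ with $$W(E')\le C\,|T|^{1/k}\,\mathrm{OPT}\qquad\text{and}\qquad W(E')\le C\,|T|^{1/k}\,W(\mathrm{ST}(G,T)).$$ -/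

import Mathlib

open scoped NNReal ENNReal

namespace SubsetSpanner

/-! ### Weighted graphs, distances and subsetwise spanners -/

section Graphs

variable {V : Type*}

/-- Length of a walk: the sum of the weights of its edges. -/
noncomputable def walkWeight {G : SimpleGraph V} (w : Sym2 V → ℝ≥0) {u v : V}
    (p : G.Walk u v) : ℝ≥0 :=
  (p.edges.map w).sum

/-- Weighted shortest-path distance; it is `∞` if `u` and `v` are not connected in `G`. -/
noncomputable def wdist (G : SimpleGraph V) (w : Sym2 V → ℝ≥0) (u v : V) : ℝ≥0∞ :=
  ⨅ p : G.Walk u v, (walkWeight w p : ℝ≥0∞)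

theorem walkWeight_reverse {G : SimpleGraph V} (w : Sym2 V → ℝ≥0) {u v : V}
    (p : G.Walk u v) : walkWeight w p.reverse = walkWeight w p := by
  simp [walkWeight, SimpleGraph.Walk.edges_reverse, List.map_reverse, List.sum_reverse]

theorem wdist_comm (G : SimpleGraph V) (w : Sym2 V → ℝ≥0) (u v : V) :
    wdist G w u v = wdist G w v u := by
  apply le_antisymm
  · exact le_iInf fun p => (iInf_le _ p.reverse).trans (by rw [walkWeight_reverse])
  · exact le_iInf fun p => (iInf_le _ p.reverse).trans (by rw [walkWeight_reverse])

/-- Total weight of a set of edges. -/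
noncomputable def edgeWeight [Finite V] (w : Sym2 V → ℝ≥0) (S : Set (Sym2 V)) : ℝ≥0 :=
  ∑ e ∈ S.toFinite.toFinset, w e

/-- `H` is a subsetwise (multiplicative) `t`-spanner of `G` over the terminals `T`.  For
`T = Set.univ` it is a `t`-spanner of `G`. -/
def IsSubsetwiseSpanner (G : SimpleGraph V) (w : Sym2 V → ℝ≥0) (T : Set V) (t : ℝ)
    (H : G.Subgraph) : Prop :=
  T ⊆ H.verts ∧
    ∀ u ∈ T, ∀ v ∈ T, wdist H.spanningCoe w u v ≤ ENNReal.ofReal t * wdist G w u v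

/-- `OPT`: the minimum weight of a subsetwise `t`-spanner of `G` over `T`. -/
noncomputable def optWeight [Finite V] (G : SimpleGraph V) (w : Sym2 V → ℝ≥0) (T : Set V)
    (t : ℝ) : ℝ≥0 :=
  sInf {x | ∃ H : G.Subgraph, IsSubsetwiseSpanner G w T t H ∧ x = edgeWeight w H.edgeSet}

/-- `W(ST(G,T))`: the minimum weight of a subtree of `G` that contains all terminals. -/
noncomputable def steinerWeight [Finite V] (G : SimpleGraph V) (w : Sym2 V → ℝ≥0)
    (T : Set V) : ℝ≥0 :=
  sInf {x | ∃ H : G.Subgraph, H.coe.IsTree ∧ T ⊆ H.verts ∧ x = edgeWeight w H.edgeSet}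

/-- Edge weights of the metric closure of `G` over `T`, which is the complete graph on `T`:
the edge `{u, v}` has weight `d_G(u, v)`. -/
noncomputable def closureWeight (G : SimpleGraph V) (w : Sym2 V → ℝ≥0) (T : Finset V) :
    Sym2 T → ℝ≥0 :=
  Sym2.lift ⟨fun u v => (wdist G w u v).toNNReal, fun u v => by
    change (wdist G w u v).toNNReal = (wdist G w v u).toNNReal
    rw [wdist_comm]⟩

/-- The subgraph of `G` with the edges of `G` that lie in `E`, whose vertices are those of `T`
and the end points of these edges. -/
def subgraphOfEdges (G : SimpleGraph V) (T : Set V) (E : Set (Sym2 V)) : G.Subgraph where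
  verts := T ∪ {u | ∃ v, G.Adj u v ∧ s(u, v) ∈ E}
  Adj u v := G.Adj u v ∧ s(u, v) ∈ E
  adj_sub h := h.1
  edge_vert {_ v} h := Or.inr ⟨v, h⟩
  symm := ⟨fun u v h => ⟨h.1.symm, by rw [Sym2.eq_swap]; exact h.2⟩⟩

/-- `R` assigns to every pair `{u, v}` of terminals the edge set of some shortest `u`-`v` path
in `G`. -/
def IsShortestPathChoice (G : SimpleGraph V) (w : Sym2 V → ℝ≥0) (T : Finset V)
    (R : Sym2 T → Set (Sym2 V)) : Prop :=
  ∀ u v : T, ∃ p : G.Walk u v,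
    p.IsPath ∧ (walkWeight w p : ℝ≥0∞) = wdist G w u v ∧ R s(u, v) = {e | e ∈ p.edges}

end Graphs

/-! ### A real RAM, programmed in a small imperative language

The memory consists of arrays of natural numbers and arrays of real numbers.  The name of an
array is a literal of the program (so that a program has finitely many arrays), the index is
computed.  The input is a matrix of reals that can be read entrywise.  The available operations
are addition and truncated subtraction of naturals, the four field operations on reals, the
inclusion of the naturals into the reals, and comparisons; there is no rounding of reals to
naturals and no multiplication of naturals at unit cost. -/

/-- Expressions with values in the natural numbers. -/
inductive NExp : Type
  | lit (n : ℕ)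
  | get (a : ℕ) (i : NExp)
  | add (x y : NExp)
  | sub (x y : NExp)

/-- Expressions with values in the real numbers. -/
inductive RExp : Type
  | ofNat (x : NExp)
  | get (a : ℕ) (i : NExp)
  | input (i j : NExp)
  | add (x y : RExp)
  | sub (x y : RExp)
  | mul (x y : RExp)
  | div (x y : RExp)

/-- Tests. -/
inductive BExp : Type
  | nlt (x y : NExp)
  | rlt (x y : RExp)
  | not (b : BExp)
  | and (b c : BExp)

/-- Programs. `emit i j` appends the pair `(i, j)` to the write-only output. -/
inductive Prog : Type
  | skip
  | nset (a : ℕ) (i x : NExp)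
  | rset (a : ℕ) (i : NExp) (x : RExp)
  | emit (i j : NExp)
  | seq (p q : Prog)
  | ite (b : BExp) (p q : Prog)
  | loop (b : BExp) (p : Prog)

/-- Machine states. -/
structure State : Type where
  nmem : ℕ → ℕ → ℕ
  rmem : ℕ → ℕ → ℝ
  out : List (ℕ × ℕ)

def NExp.eval (s : State) : NExp → ℕ
  | lit n => n
  | get a i => s.nmem a (i.eval s)
  | add x y => x.eval s + y.eval s
  | sub x y => x.eval s - y.eval s

noncomputable def RExp.eval (D : ℕ → ℕ → ℝ) (s : State) : RExp → ℝ
  | ofNat x => (x.eval s : ℝ)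
  | get a i => s.rmem a (i.eval s)
  | input i j => D (i.eval s) (j.eval s)
  | add x y => x.eval D s + y.eval D s
  | sub x y => x.eval D s - y.eval D s
  | mul x y => x.eval D s * y.eval D s
  | div x y => x.eval D s / y.eval D s

def BExp.holds (D : ℕ → ℕ → ℝ) (s : State) : BExp → Prop
  | nlt x y => x.eval s < y.eval s
  | rlt x y => x.eval D s < y.eval D s
  | not b => ¬ b.holds D s
  | and b c => b.holds D s ∧ c.holds D s

/-- Write `x` into cell `i` of array `a`. -/
def write {α : Type} (m : ℕ → ℕ → α) (a i : ℕ) (x : α) : ℕ → ℕ → α :=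
  Function.update m a (Function.update (m a) i x)

/-- `Exec D p s c s'`: on the input matrix `D`, the program `p` started in the state `s` halts
in the state `s'` after `c` steps.  Every executed elementary command and every evaluated test
is one step; the expressions in a program have fixed size, so charging each of their operations
separately would change `c` only by a factor that depends on the program alone. -/
inductive Exec (D : ℕ → ℕ → ℝ) : Prog → State → ℕ → State → Prop
  | skip (s : State) : Exec D .skip s 1 s
  | nset (a : ℕ) (i x : NExp) (s : State) :
      Exec D (.nset a i x) s 1 { s with nmem := write s.nmem a (i.eval s) (x.eval s) }
  | rset (a : ℕ) (i : NExp) (x : RExp) (s : State) :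
      Exec D (.rset a i x) s 1 { s with rmem := write s.rmem a (i.eval s) (x.eval D s) }
  | emit (i j : NExp) (s : State) :
      Exec D (.emit i j) s 1 { s with out := s.out ++ [(i.eval s, j.eval s)] }
  | seq {p q : Prog} {s s₁ s₂ : State} {c₁ c₂ : ℕ} :
      Exec D p s c₁ s₁ → Exec D q s₁ c₂ s₂ → Exec D (.seq p q) s (c₁ + c₂) s₂
  | ite_true {b : BExp} {p q : Prog} {s s₁ : State} {c : ℕ} :
      b.holds D s → Exec D p s c s₁ → Exec D (.ite b p q) s (c + 1) s₁
  | ite_false {b : BExp} {p q : Prog} {s s₁ : State} {c : ℕ} :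
      ¬ b.holds D s → Exec D q s c s₁ → Exec D (.ite b p q) s (c + 1) s₁
  | loop_true {b : BExp} {p : Prog} {s s₁ s₂ : State} {c₁ c₂ : ℕ} :
      b.holds D s → Exec D p s c₁ s₁ → Exec D (.loop b p) s₁ c₂ s₂ →
        Exec D (.loop b p) s (c₁ + c₂ + 1) s₂
  | loop_false {b : BExp} {p : Prog} {s : State} :
      ¬ b.holds D s → Exec D (.loop b p) s 1 s

/-- Initial state: the numbers `n` and `k` are in cells `0` and `1` of the array `0` of naturals,
`ε` is in cell `0` of the array `0` of reals; all other cells are `0`. -/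
noncomputable def initState (n k : ℕ) (ε : ℝ) : State where
  nmem := write (write (fun _ _ => 0) 0 0 n) 0 1 k
  rmem := write (fun _ _ => 0) 0 0 ε
  out := []

/-! ### The metric closure construction -/

section Algorithm

variable {V : Type*}

/-- The distance matrix of the metric closure of `G` over `T`, for the numbering `τ` of the
terminals; this is the input of the spanner subroutine. -/
noncomputable def closureMatrix (G : SimpleGraph V) (w : Sym2 V → ℝ≥0) (T : Finset V)
    (τ : Fin T.card ≃ T) (i j : ℕ) : ℝ :=
  if h : i < T.card ∧ j < T.card then
    (closureWeight G w T s(τ ⟨i, h.1⟩, τ ⟨j, h.2⟩) : ℝ) else 0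

/-- The subgraph of the metric closure with the edges listed in the output of the subroutine. -/
def closureSpanner (T : Finset V) (τ : Fin T.card ≃ T) (out : List (ℕ × ℕ)) :
    (⊤ : SimpleGraph T).Subgraph :=
  subgraphOfEdges ⊤ Set.univ
    {e | ∃ i j : Fin T.card, ((i : ℕ), (j : ℕ)) ∈ out ∧ e = s(τ i, τ j)}

/-- The subgraph of `G` returned by the construction: each edge `{u, v}` of the spanner `H` of
the metric closure is replaced by the chosen shortest `u`-`v` path of `G`. -/
def expand (G : SimpleGraph V) (T : Finset V) (R : Sym2 T → Set (Sym2 V))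
    (H : (⊤ : SimpleGraph T).Subgraph) : G.Subgraph :=
  subgraphOfEdges G T (⋃ e ∈ H.edgeSet, R e)

end Algorithm

end SubsetSpanner

namespace SubsetSpanner

/-! ### Finite metrics given by matrices -/

/-! Only two properties of the matrix `D` of terminal distances are used: it is a pseudometric, and
it satisfies a packing bound. Let H be a subgraph of G of weight X that connects the terminals.
Balls of radius ρ/2 around m ≥ 2 terminals at mutual distances at least ρ have disjoint interiors,
and H spends at least ρ/2 in each of them, so mρ ≤ 2X (`Pack`, from
`card_mul_le_two_mul_edgeWeight`). Finite stretch forces every subsetwise spanner to connect the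
terminals, and every Steiner tree does so too. Hence a bound in terms of an arbitrary X with `Pack`
gives both weight bounds at once.

The subroutine works scale by scale. The sum S of the distances from terminal 0 bounds every
distance and is at most nX. All pairs at distance at most S/n³ are emitted directly, at total cost
at most S/n ≤ X. Then w runs through S/n³ · (1+δ)^j until it reaches S, where δ = ε/(5+5ε).

At scale w, a net of q points reaches every point within δw along emitted edges. Around each net
point still alive a ball is grown in steps of W = (1+3δ)w. Its size cannot grow k times by a factor
above q^{1/k}, so for some m < k the step from mW to (m+1)W grows it by at most that factor. The
centre is joined to the outer ball and the inner ball is killed. Net points at distance at most W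
thus get a path of length at most (2k-1)W, and each killed point pays for about q^{1/k} edges of
length at most kW (`runs_ballsProg`). Finally the net is thinned to separation δ²w (`runs_netProg`),
so that packing gives q ≤ Y/w at the next scale if q ≥ 2, with Y = 4X/δ².

The cost of a scale is therefore O(k · w q^{1+1/k}) with q ≤ min(n, Y/w), and a single net point
costs nothing. This bound grows geometrically in w up to w = Y/n and decays like w^{-1/k}
afterwards, so the sum is O(Y n^{1/k}) without a logarithm. `potential` performs the summation by
telescoping, inside the invariant `ScaleInv`. The O(log n) scales take O(k n²) steps each, and log n
≤ k n^{1/k}. -/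

/-- The first `n` rows and columns of `D` are a (pseudo)metric. -/
structure IsMetric (D : ℕ → ℕ → ℝ) (n : ℕ) : Prop where
  self : ∀ i, D i i = 0
  symm : ∀ i j, D i j = D j i
  nonneg : ∀ i j, 0 ≤ D i j
  triangle : ∀ i j l, i < n → j < n → l < n → D i l ≤ D i j + D j l

/-- There is a path from `i` to `j` of length at most `ℓ` whose edges are listed in `o`. -/
inductive Reach (D : ℕ → ℕ → ℝ) (n : ℕ) (o : List (ℕ × ℕ)) : ℕ → ℕ → ℝ → Prop
  | refl {i : ℕ} {ℓ : ℝ} : i < n → 0 ≤ ℓ → Reach D n o i i ℓ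
  | edge {i j : ℕ} {ℓ : ℝ} : i < n → j < n → (i, j) ∈ o → D i j ≤ ℓ → Reach D n o i j ℓ
  | symm {i j : ℕ} {ℓ : ℝ} : Reach D n o i j ℓ → Reach D n o j i ℓ
  | trans {i j l : ℕ} {ℓ m : ℝ} :
      Reach D n o i j ℓ → Reach D n o j l m → Reach D n o i l (ℓ + m)

/-- Total weight of a list of edges. -/
def listWeight (D : ℕ → ℕ → ℝ) (o : List (ℕ × ℕ)) : ℝ :=
  (o.map fun p => D p.1 p.2).sum

/-- A set of `m ≥ 2` points with mutual distances at least `ρ` satisfies `m * ρ ≤ 2 * X`. -/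
structure Pack (D : ℕ → ℕ → ℝ) (n : ℕ) (X : ℝ) : Prop where
  nonneg : 0 ≤ X
  bound : ∀ (F : Finset ℕ) (ρ : ℝ), 0 ≤ ρ → 2 ≤ F.card → (∀ a ∈ F, a < n) →
    (∀ a ∈ F, ∀ b ∈ F, a ≠ b → ρ ≤ D a b) → F.card * ρ ≤ 2 * X

theorem Reach.lt {D : ℕ → ℕ → ℝ} {n : ℕ} {o : List (ℕ × ℕ)} {i j : ℕ} {ℓ : ℝ}
    (h : Reach D n o i j ℓ) : i < n ∧ j < n := by
  induction h with
  | refl h _ => exact ⟨h, h⟩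
  | edge h h' _ _ => exact ⟨h, h'⟩
  | symm _ ih => exact ih.symm
  | trans _ _ ih ih' => exact ⟨ih.1, ih'.2⟩

/-! ### Weighted distances -/

section Graphs

variable {V : Type*}

theorem wdist_self (G : SimpleGraph V) (w : Sym2 V → ℝ≥0) (u : V) : wdist G w u u = 0 :=
  le_antisymm ((iInf_le _ SimpleGraph.Walk.nil).trans (by simp [walkWeight])) bot_le

theorem wdist_triangle (G : SimpleGraph V) (w : Sym2 V → ℝ≥0) (u v x : V) :
    wdist G w u x ≤ wdist G w u v + wdist G w v x := by
  simp only [wdist, ENNReal.iInf_add, ENNReal.add_iInf]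
  refine le_iInf fun p => le_iInf fun q => (iInf_le _ (q.append p)).trans ?_
  simp [walkWeight, SimpleGraph.Walk.edges_append]

theorem wdist_le_of_adj {G : SimpleGraph V} (w : Sym2 V → ℝ≥0) {u v : V} (h : G.Adj u v) :
    wdist G w u v ≤ w s(u, v) :=
  (iInf_le _ (SimpleGraph.Walk.cons h SimpleGraph.Walk.nil)).trans (by simp [walkWeight])

theorem wdist_ne_top {G : SimpleGraph V} (hG : G.Connected) (w : Sym2 V → ℝ≥0) (u v : V) :
    wdist G w u v ≠ ∞ := by
  obtain ⟨p⟩ := hG.preconnected u v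
  exact ((iInf_le _ p).trans_lt ENNReal.coe_lt_top).ne

theorem coe_closureWeight {G : SimpleGraph V} (hG : G.Connected) (w : Sym2 V → ℝ≥0)
    (T : Finset V) (u v : T) : (closureWeight G w T s(u, v) : ℝ≥0∞) = wdist G w u v :=
  ENNReal.coe_toNNReal (wdist_ne_top hG w u v)

theorem closureMatrix_apply (G : SimpleGraph V) (w : Sym2 V → ℝ≥0) (T : Finset V)
    (τ : Fin T.card ≃ T) (i j : Fin T.card) :
    closureMatrix G w T τ i j = (wdist G w (τ i) (τ j)).toReal := by
  simp [closureMatrix, closureWeight, ENNReal.coe_toNNReal_eq_toReal]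

theorem toReal_wdist_triangle {G : SimpleGraph V} (hG : G.Connected) (w : Sym2 V → ℝ≥0)
    (u v x : V) :
    (wdist G w u x).toReal ≤ (wdist G w u v).toReal + (wdist G w v x).toReal := by
  rw [← ENNReal.toReal_add (wdist_ne_top hG w u v) (wdist_ne_top hG w v x)]
  exact ENNReal.toReal_mono
    (ENNReal.add_ne_top.2 ⟨wdist_ne_top hG w u v, wdist_ne_top hG w v x⟩)
    (wdist_triangle G w u v x)

theorem isMetric_closureMatrix {G : SimpleGraph V} (hG : G.Connected) (w : Sym2 V → ℝ≥0)
    (T : Finset V) (τ : Fin T.card ≃ T) : IsMetric (closureMatrix G w T τ) T.card where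
  self i := by
    by_cases h : i < T.card
    · rw [closureMatrix_apply G w T τ ⟨i, h⟩ ⟨i, h⟩, wdist_self, ENNReal.toReal_zero]
    · simp [closureMatrix, h]
  symm i j := by
    unfold closureMatrix
    by_cases h : i < T.card ∧ j < T.card
    · rw [dif_pos h, dif_pos h.symm, Sym2.eq_swap]
    · rw [dif_neg h, dif_neg fun h' => h h'.symm]
  nonneg i j := by
    unfold closureMatrix
    split_ifs
    · exact NNReal.coe_nonneg _
    · exact le_rfl
  triangle i j l hi hj hl := by
    rw [closureMatrix_apply G w T τ ⟨i, hi⟩ ⟨j, hj⟩, closureMatrix_apply G w T τ ⟨i, hi⟩ ⟨l, hl⟩,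
      closureMatrix_apply G w T τ ⟨j, hj⟩ ⟨l, hl⟩]
    exact toReal_wdist_triangle hG w _ _ _

/-- Nonnegativity of ℓ is carried through the induction because `ENNReal.ofReal` splits a sum only
for nonnegative summands. -/
theorem wdist_closureSpanner_le {G : SimpleGraph V} (hG : G.Connected) (w : Sym2 V → ℝ≥0)
    (T : Finset V) (τ : Fin T.card ≃ T) {o : List (ℕ × ℕ)} {i j : ℕ} {ℓ : ℝ}
    (h : Reach (closureMatrix G w T τ) T.card o i j ℓ) (hi : i < T.card) (hj : j < T.card) :
    0 ≤ ℓ ∧ wdist (closureSpanner T τ o).spanningCoe (closureWeight G w T) (τ ⟨i, hi⟩)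
      (τ ⟨j, hj⟩) ≤ ENNReal.ofReal ℓ := by
  induction h with
  | refl h hℓ => exact ⟨hℓ, by rw [wdist_self]; exact bot_le⟩
  | @edge i j ℓ _ _ hm hd =>
    have hm' := closureMatrix_apply G w T τ ⟨i, hi⟩ ⟨j, hj⟩
    refine ⟨((isMetric_closureMatrix hG w T τ).nonneg i j).trans hd, ?_⟩
    by_cases hij : τ ⟨i, hi⟩ = τ ⟨j, hj⟩
    · rw [hij, wdist_self]; exact bot_le
    · have hadj : (closureSpanner T τ o).spanningCoe.Adj (τ ⟨i, hi⟩) (τ ⟨j, hj⟩) :=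
        ⟨hij, ⟨⟨i, hi⟩, ⟨j, hj⟩, hm, rfl⟩⟩
      refine (wdist_le_of_adj _ hadj).trans ?_
      rw [coe_closureWeight hG, ← ENNReal.ofReal_toReal (wdist_ne_top hG w _ _)]
      exact ENNReal.ofReal_le_ofReal (hm' ▸ hd)
  | symm _ ih =>
    rw [wdist_comm]
    exact ih hj hi
  | @trans i j l ℓ m h h' ih ih' =>
    have hl := h.lt.2
    obtain ⟨h0, h1⟩ := ih hi hl
    obtain ⟨h0', h1'⟩ := ih' hl hj
    refine ⟨add_nonneg h0 h0', (wdist_triangle _ _ _ (τ ⟨j, hl⟩) _).trans ?_⟩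
    rw [ENNReal.ofReal_add h0 h0']
    exact add_le_add h1 h1'

/-- Triangle inequality along a closure walk. It turns stretch relative to d_G into stretch relative
to the distances of the closure itself. -/
theorem wdist_le_wdist_closure {G : SimpleGraph V} (hG : G.Connected) (w : Sym2 V → ℝ≥0)
    (T : Finset V) (u v : T) :
    wdist G w u v ≤ wdist (⊤ : SimpleGraph T) (closureWeight G w T) u v := by
  refine le_iInf fun p => ?_
  induction p with
  | nil => rw [wdist_self]; exact bot_le
  | @cons a b c h p ih =>
    refine (wdist_triangle G w a b c).trans ?_
    simp only [walkWeight, SimpleGraph.Walk.edges_cons, List.map_cons, List.sum_cons,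
      ENNReal.coe_add] at ih ⊢
    exact add_le_add (coe_closureWeight hG w T a b).ge ih

/-- Each edge of a walk in `H` is replaced by its chosen shortest path, which survives in the
expansion and has the same length as the edge. -/
theorem wdist_expand_le {G : SimpleGraph V} (hG : G.Connected) (w : Sym2 V → ℝ≥0)
    (T : Finset V) {R : Sym2 T → Set (Sym2 V)} (hR : IsShortestPathChoice G w T R)
    (H : (⊤ : SimpleGraph T).Subgraph) (u v : T) :
    wdist (expand G T R H).spanningCoe w u v ≤
      wdist H.spanningCoe (closureWeight G w T) u v := by
  refine le_iInf fun p => ?_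
  induction p with
  | nil => rw [wdist_self]; exact bot_le
  | @cons a b c h p ih =>
    refine (wdist_triangle _ w a b c).trans ?_
    simp only [walkWeight, SimpleGraph.Walk.edges_cons, List.map_cons, List.sum_cons,
      ENNReal.coe_add] at ih ⊢
    refine add_le_add ?_ ih
    obtain ⟨q, -, hq, hqR⟩ := hR a b
    have hmem : ∀ e ∈ q.edges, e ∈ (expand G T R H).spanningCoe.edgeSet := by
      intro e he
      have heG := q.edges_subset_edgeSet he
      have heR : e ∈ ⋃ e ∈ H.edgeSet, R e :=
        Set.mem_biUnion (show s(a, b) ∈ H.edgeSet from h) (hqR ▸ he)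
      induction e with
      | _ x y => exact ⟨heG, heR⟩
    rw [coe_closureWeight hG, ← hq]
    exact (iInf_le _ (q.transfer _ hmem)).trans (by simp [walkWeight])

/-- Elements covered by the head of the list are charged to it and the rest to the tail; overlaps
only help. Quantifying over finite subsets of `A x` avoids any finiteness assumption on `A x`. -/
theorem sum_le_list_sum_of_cover {α β : Type*} (f : α → ℝ≥0) (A : β → Set α) (g : β → ℝ)
    (l : List β) (hA : ∀ x ∈ l, ∀ F : Finset α, ↑F ⊆ A x → ((∑ a ∈ F, f a : ℝ≥0) : ℝ) ≤ g x)
    (F : Finset α) (hF : ∀ a ∈ F, ∃ x ∈ l, a ∈ A x) :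
    ((∑ a ∈ F, f a : ℝ≥0) : ℝ) ≤ (l.map g).sum := by
  classical
  induction l generalizing F with
  | nil =>
    have : F = ∅ := Finset.eq_empty_of_forall_notMem fun a ha => by simpa using hF a ha
    simp [this]
  | cons x l ih =>
    rw [List.map_cons, List.sum_cons, ← Finset.sum_filter_add_sum_filter_not F (· ∈ A x),
      NNReal.coe_add]
    refine add_le_add (hA x List.mem_cons_self _ fun a ha => by simpa using (by simpa using ha :
      a ∈ F ∧ a ∈ A x).2) (ih (fun y hy => hA y (List.mem_cons_of_mem _ hy)) _ fun a ha => ?_)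
    rw [Finset.mem_filter] at ha
    obtain ⟨y, hy, hay⟩ := hF a ha.1
    rcases List.mem_cons.1 hy with rfl | hy
    · exact absurd hay ha.2
    · exact ⟨y, hy, hay⟩

theorem edgeWeight_expand_le [Finite V] {G : SimpleGraph V} (hG : G.Connected)
    (w : Sym2 V → ℝ≥0) (T : Finset V) (τ : Fin T.card ≃ T) {R : Sym2 T → Set (Sym2 V)}
    (hR : IsShortestPathChoice G w T R) (o : List (ℕ × ℕ)) :
    (edgeWeight w (expand G T R (closureSpanner T τ o)).edgeSet : ℝ) ≤
      listWeight (closureMatrix G w T τ) o := by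
  classical
  unfold edgeWeight listWeight
  -- Pairs of the list outside the index range get the empty set, so nothing need be known about the
  -- output.
  refine sum_le_list_sum_of_cover w
    (fun x => {e | ∃ i j : Fin T.card, x = ((i : ℕ), (j : ℕ)) ∧ e ∈ R s(τ i, τ j)}) _ o ?_ _ ?_
  · rintro x - F hF
    rcases F.eq_empty_or_nonempty with rfl | ⟨e, he⟩
    · simpa using (isMetric_closureMatrix hG w T τ).nonneg _ _
    obtain ⟨i, j, rfl, -⟩ := hF he
    obtain ⟨p, hp, hpw, hpR⟩ := hR (τ i) (τ j)
    rw [closureMatrix_apply, ← hpw, ENNReal.coe_toReal, NNReal.coe_le_coe, walkWeight,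
      ← List.sum_toFinset _ hp.isTrail.edges_nodup]
    refine Finset.sum_le_sum_of_subset fun e he => ?_
    obtain ⟨i', j', hij, he'⟩ := hF he
    simp only [Prod.mk.injEq, Fin.val_inj] at hij
    rw [← hij.1, ← hij.2, hpR] at he'
    exact List.mem_toFinset.2 he'
  · intro e he
    have he' : e ∈ (expand G T R (closureSpanner T τ o)).edgeSet := by simpa using he
    have : e ∈ ⋃ e ∈ (closureSpanner T τ o).edgeSet, R e := by
      induction e with
      | _ x y => exact he'.2
    obtain ⟨f, hf, hef⟩ := Set.mem_iUnion₂.1 this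
    have : ∃ i j : Fin T.card, ((i : ℕ), (j : ℕ)) ∈ o ∧ f = s(τ i, τ j) := by
      induction f with
      | _ x y => exact hf.2
    obtain ⟨i, j, hij, rfl⟩ := this
    exact ⟨_, hij, i, j, rfl, hef⟩

/-! ### Packing -/

/-- The part of the ball of radius `r` around `c` that lies beyond `x`. -/
noncomputable def cap (G : SimpleGraph V) (w : Sym2 V → ℝ≥0) (r : ℝ) (c x : V) : ℝ :=
  max 0 (r - (wdist G w c x).toReal)

theorem cap_nonneg (G : SimpleGraph V) (w : Sym2 V → ℝ≥0) (r : ℝ) (c x : V) :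
    0 ≤ cap G w r c x := le_max_left _ _

theorem cap_of_pos {G : SimpleGraph V} {w : Sym2 V → ℝ≥0} {r : ℝ} {c x : V}
    (h : 0 < cap G w r c x) : cap G w r c x = r - (wdist G w c x).toReal := by
  unfold cap at h ⊢
  rcases lt_max_iff.1 h with h | h
  · exact absurd h (lt_irrefl 0)
  · exact max_eq_right h.le

theorem abs_cap_sub_cap_le {G : SimpleGraph V} (hG : G.Connected) (w : Sym2 V → ℝ≥0) (r : ℝ)
    (c : V) {a b : V} (hab : G.Adj a b) :
    |cap G w r c a - cap G w r c b| ≤ w s(a, b) := by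
  have h0 : (wdist G w a b).toReal ≤ w s(a, b) :=
    ENNReal.toReal_mono ENNReal.coe_ne_top (wdist_le_of_adj w hab)
  have h1 := toReal_wdist_triangle hG w c a b
  have h2 := toReal_wdist_triangle hG w c b a
  rw [wdist_comm G w b a] at h2
  refine (abs_max_sub_max_le_max _ _ _ _).trans (max_le (by simp) ?_)
  rw [abs_le]
  constructor <;> linarith

/-- The open balls of radius ρ/2 around `F` are disjoint, so each endpoint has a positive cap for at
most one centre. If a and b belong to different centres c and c', the sum is ρ - d(c,a) - d(c',b) ≤
d(a,b), because ρ ≤ d(c,c'). -/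
theorem sum_abs_cap_sub_cap_le {G : SimpleGraph V} (hG : G.Connected) (w : Sym2 V → ℝ≥0)
    {ρ : ℝ} {F : Finset V}
    (hF : ∀ a ∈ F, ∀ b ∈ F, a ≠ b → ρ ≤ (wdist G w a b).toReal) {a b : V} (hab : G.Adj a b) :
    ∑ c ∈ F, |cap G w (ρ / 2) c a - cap G w (ρ / 2) c b| ≤ w s(a, b) := by
  have h0 : (wdist G w a b).toReal ≤ w s(a, b) :=
    ENNReal.toReal_mono ENNReal.coe_ne_top (wdist_le_of_adj w hab)
  have huniq : ∀ x, ∀ c ∈ F, ∀ c' ∈ F, c' ≠ c → 0 < cap G w (ρ / 2) c x →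
      cap G w (ρ / 2) c' x = 0 := by
    intro x c hc c' hc' hne hpos
    by_contra hne0
    have hpos' := (cap_nonneg G w (ρ / 2) c' x).lt_of_ne' hne0
    have e := cap_of_pos hpos
    have e' := cap_of_pos hpos'
    have h1 := hF c' hc' c hc hne
    have h2 := toReal_wdist_triangle hG w c' x c
    rw [wdist_comm G w x c] at h2
    linarith
  have hzero : ∀ x c, ¬ 0 < cap G w (ρ / 2) c x → cap G w (ρ / 2) c x = 0 := fun x c h =>
    le_antisymm (not_lt.1 h) (cap_nonneg _ _ _ _ _)
  by_cases ha : ∃ c ∈ F, 0 < cap G w (ρ / 2) c a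
  · obtain ⟨c, hc, hca⟩ := ha
    by_cases hb : ∃ c' ∈ F, c' ≠ c ∧ 0 < cap G w (ρ / 2) c' b
    · obtain ⟨c', hc', hne, hcb⟩ := hb
      rw [Finset.sum_eq_add_of_mem c c' hc hc' hne.symm]
      · rw [huniq a c hc c' hc' hne hca, huniq b c' hc' c hc hne.symm hcb, sub_zero, zero_sub,
          abs_neg, abs_of_pos hca, abs_of_pos hcb, cap_of_pos hca, cap_of_pos hcb]
        have h1 := hF c hc c' hc' hne.symm
        have h2 := toReal_wdist_triangle hG w c a c'
        have h3 := toReal_wdist_triangle hG w a b c'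
        rw [wdist_comm G w b c'] at h3
        linarith
      · rintro x hx ⟨h1, h2⟩
        rw [huniq a c hc x hx h1 hca, huniq b c' hc' x hx h2 hcb, sub_zero, abs_zero]
    · push Not at hb
      rw [Finset.sum_eq_single_of_mem c hc]
      · exact abs_cap_sub_cap_le hG w _ c hab
      · intro x hx hne
        rw [huniq a c hc x hx hne hca, hzero b x (hb x hx hne).not_gt, sub_zero, abs_zero]
  · push Not at ha
    by_cases hb : ∃ c ∈ F, 0 < cap G w (ρ / 2) c b
    · obtain ⟨c, hc, hcb⟩ := hb
      rw [Finset.sum_eq_single_of_mem c hc]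
      · exact abs_cap_sub_cap_le hG w _ c hab
      · intro x hx hne
        rw [huniq b c hc x hx hne hcb, hzero a x (ha x hx).not_gt, sub_zero, abs_zero]
    · push Not at hb
      rw [Finset.sum_eq_zero]
      · exact NNReal.coe_nonneg _
      · intro x hx
        rw [hzero a x (ha x hx).not_gt, hzero b x (hb x hx).not_gt, sub_zero, abs_zero]

/-- The cap of c falls from ρ/2 at c to 0 at any other point of `F`, so its variation over the edges
of `H` is at least ρ/2. Summing over c and exchanging the sums compares this with the weight of `H`.
The second point of `F` is what forces `H` to leave the ball. -/
theorem card_mul_le_two_mul_edgeWeight [Finite V] {G : SimpleGraph V} (hG : G.Connected)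
    (w : Sym2 V → ℝ≥0) (H : G.Subgraph) {ρ : ℝ} (hρ : 0 ≤ ρ) {F : Finset V} (hcard : 2 ≤ F.card)
    (hF : ∀ a ∈ F, ∀ b ∈ F, a ≠ b → ρ ≤ (wdist G w a b).toReal)
    (hH : ∀ a ∈ F, ∀ b ∈ F, H.spanningCoe.Reachable a b) :
    F.card * ρ ≤ 2 * (edgeWeight w H.edgeSet : ℝ) := by
  classical
  let Δ : V → Sym2 V → ℝ := fun c => Sym2.lift
    ⟨fun a b => |cap G w (ρ / 2) c a - cap G w (ρ / 2) c b|, fun a b => abs_sub_comm _ _⟩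
  have hΔ : ∀ c e, 0 ≤ Δ c e := by
    intro c e
    induction e with
    | _ x y => exact abs_nonneg _
  have hwalk : ∀ (c a b : V) (p : H.spanningCoe.Walk a b),
      cap G w (ρ / 2) c a - cap G w (ρ / 2) c b ≤ (p.edges.map (Δ c)).sum := by
    intro c a b p
    induction p with
    | nil => simp
    | @cons x y z h p ih =>
      simp only [SimpleGraph.Walk.edges_cons, List.map_cons, List.sum_cons]
      have : cap G w (ρ / 2) c x - cap G w (ρ / 2) c y ≤ Δ c s(x, y) := le_abs_self _
      linarith
  have hball : ∀ c ∈ F, ρ / 2 ≤ ∑ e ∈ H.edgeSet.toFinite.toFinset, Δ c e := by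
    intro c hc
    obtain ⟨c', hc', hne⟩ := Finset.exists_mem_ne (s := F) (by omega) c
    obtain ⟨p, hp⟩ := (hH c hc c' hc').exists_isPath
    have h1 := hwalk c c c' p
    have e1 : cap G w (ρ / 2) c c = ρ / 2 := by
      rw [cap, wdist_self, ENNReal.toReal_zero, sub_zero]
      exact max_eq_right (by linarith)
    have e2 : cap G w (ρ / 2) c c' = 0 :=
      max_eq_left (by linarith [hF c hc c' hc' hne.symm])
    -- A path repeats no edge, so the sum along it is a sum over a set of edges of `H`.
    rw [e1, e2, sub_zero, ← List.sum_toFinset _ hp.isTrail.edges_nodup] at h1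
    refine h1.trans (Finset.sum_le_sum_of_subset_of_nonneg (fun e he => ?_) fun e _ _ => hΔ c e)
    have := p.edges_subset_edgeSet (List.mem_toFinset.1 he)
    rw [SimpleGraph.Subgraph.edgeSet_spanningCoe] at this
    simpa using this
  have h1 : F.card * (ρ / 2) ≤ ∑ c ∈ F, ∑ e ∈ H.edgeSet.toFinite.toFinset, Δ c e := by
    rw [← nsmul_eq_mul]
    exact Finset.card_nsmul_le_sum _ _ _ hball
  rw [Finset.sum_comm] at h1
  have h2 : ∑ e ∈ H.edgeSet.toFinite.toFinset, ∑ c ∈ F, Δ c e ≤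
      ∑ e ∈ H.edgeSet.toFinite.toFinset, (w e : ℝ) := by
    refine Finset.sum_le_sum fun e he => ?_
    have he' : e ∈ H.edgeSet := by simpa using he
    induction e with
    | _ x y => exact sum_abs_cap_sub_cap_le hG w hF (H.adj_sub he')
  rw [edgeWeight, NNReal.coe_sum]
  linarith

theorem pack_closureMatrix [Finite V] {G : SimpleGraph V} (hG : G.Connected)
    (w : Sym2 V → ℝ≥0) (T : Finset V) (τ : Fin T.card ≃ T) (H : G.Subgraph)
    (hH : ∀ a ∈ T, ∀ b ∈ T, H.spanningCoe.Reachable a b) :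
    Pack (closureMatrix G w T τ) T.card (edgeWeight w H.edgeSet) where
  nonneg := NNReal.coe_nonneg _
  bound F ρ hρ hcard hlt hF := by
    classical
    let f : F → V := fun i => τ ⟨i, hlt i i.2⟩
    have hf : Function.Injective f := fun i j h => by
      have := τ.injective (Subtype.ext h)
      exact Subtype.ext (by simpa using this)
    have := card_mul_le_two_mul_edgeWeight hG w H hρ (F := F.attach.map ⟨f, hf⟩)
      (by simpa using hcard) (fun a ha b hb hne => ?_) (fun a ha b hb => ?_)
    · simpa using this
    · obtain ⟨i, -, rfl⟩ := Finset.mem_map.1 ha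
      obtain ⟨j, -, rfl⟩ := Finset.mem_map.1 hb
      have := hF i i.2 j j.2 fun h => hne (by rw [Subtype.ext h])
      rwa [closureMatrix_apply G w T τ ⟨i, hlt i i.2⟩ ⟨j, hlt j j.2⟩] at this
    · obtain ⟨i, -, rfl⟩ := Finset.mem_map.1 ha
      obtain ⟨j, -, rfl⟩ := Finset.mem_map.1 hb
      exact hH _ (τ _).2 _ (τ _).2

/-! ### Subsetwise spanners and Steiner trees connect the terminals -/

/-- Otherwise the distance in `H` would be infinite, while t times the distance in the connected
graph G is finite. -/
theorem IsSubsetwiseSpanner.reachable {G : SimpleGraph V} (hG : G.Connected)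
    {w : Sym2 V → ℝ≥0} {T : Set V} {t : ℝ} {H : G.Subgraph}
    (h : IsSubsetwiseSpanner G w T t H) {a b : V} (ha : a ∈ T) (hb : b ∈ T) :
    H.spanningCoe.Reachable a b := by
  by_contra hab
  have h1 := h.2 a ha b hb
  have : IsEmpty (H.spanningCoe.Walk a b) := ⟨fun p => hab ⟨p⟩⟩
  rw [wdist, iInf_of_empty, top_le_iff] at h1
  exact ENNReal.mul_ne_top ENNReal.ofReal_ne_top (wdist_ne_top hG w a b) h1

theorem reachable_of_connected_coe {G : SimpleGraph V} {H : G.Subgraph}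
    (h : H.coe.Connected) {a b : V} (ha : a ∈ H.verts) (hb : b ∈ H.verts) :
    H.spanningCoe.Reachable a b :=
  (h.preconnected ⟨a, ha⟩ ⟨b, hb⟩).map
    (⟨Subtype.val, fun h => h⟩ : H.coe →g H.spanningCoe)

theorem isSubsetwiseSpanner_top (G : SimpleGraph V) (w : Sym2 V → ℝ≥0) (T : Set V) {t : ℝ}
    (ht : 1 ≤ t) : IsSubsetwiseSpanner G w T t ⊤ := by
  refine ⟨Set.subset_univ _, fun u _ v _ => ?_⟩
  rw [SimpleGraph.Subgraph.spanningCoe_top]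
  exact le_mul_of_one_le_left bot_le (ENNReal.one_le_ofReal.2 ht)

/-- Supplies a candidate, so that the infimum in `steinerWeight` is not the default value 0 of an
empty infimum. -/
theorem exists_isTree_coe {G : SimpleGraph V} [Finite V] (hG : G.Connected) :
    ∃ H : G.Subgraph, H.coe.IsTree ∧ H.verts = Set.univ := by
  obtain ⟨K, hK, hT⟩ := hG.exists_isTree_le
  refine ⟨SimpleGraph.toSubgraph K hK, ?_, rfl⟩
  have e : (SimpleGraph.toSubgraph K hK).coe ≃g K :=
    ⟨Equiv.Set.univ V, Iff.rfl⟩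
  exact (SimpleGraph.Iso.isTree_iff e).2 hT

/-- If x exceeded A times the infimum, some spanner would weigh less than x/A, against the bound for
its own weight. The whole graph is a candidate, so the infimum is not over the empty set. -/
theorem le_mul_optWeight [Finite V] {G : SimpleGraph V} (hG : G.Connected)
    (w : Sym2 V → ℝ≥0) (T : Finset V) (τ : Fin T.card ≃ T) {t : ℝ} (ht : 1 ≤ t) {x A : ℝ}
    (hA : 0 < A) (h : ∀ X, Pack (closureMatrix G w T τ) T.card X → x ≤ A * X) :
    x ≤ A * optWeight G w T t := by
  rw [← div_le_iff₀' hA]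
  by_contra hlt
  obtain ⟨y, ⟨H, hH, rfl⟩, hy⟩ := exists_lt_of_csInf_lt
    (s := {x | ∃ H : G.Subgraph, IsSubsetwiseSpanner G w T t H ∧ x = edgeWeight w H.edgeSet})
    ⟨_, ⊤, isSubsetwiseSpanner_top G w T ht, rfl⟩
    (show optWeight G w T t < (x / A).toNNReal from
      Real.lt_toNNReal_iff_coe_lt.2 (not_le.1 hlt))
  refine (Real.lt_toNNReal_iff_coe_lt.1 hy).not_ge ?_
  rw [div_le_iff₀' hA]
  exact h _ (pack_closureMatrix hG w T τ H fun a ha b hb => hH.reachable hG ha hb)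

theorem le_mul_steinerWeight [Finite V] {G : SimpleGraph V} (hG : G.Connected)
    (w : Sym2 V → ℝ≥0) (T : Finset V) (τ : Fin T.card ≃ T) {x A : ℝ}
    (hA : 0 < A) (h : ∀ X, Pack (closureMatrix G w T τ) T.card X → x ≤ A * X) :
    x ≤ A * steinerWeight G w T := by
  rw [← div_le_iff₀' hA]
  by_contra hlt
  obtain ⟨H₀, hH₀, hv⟩ := exists_isTree_coe hG
  obtain ⟨y, ⟨H, hH, hTH, rfl⟩, hy⟩ := exists_lt_of_csInf_lt
    (s := {x | ∃ H : G.Subgraph, H.coe.IsTree ∧ ↑T ⊆ H.verts ∧ x = edgeWeight w H.edgeSet})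
    ⟨_, H₀, hH₀, hv ▸ Set.subset_univ _, rfl⟩
    (show steinerWeight G w T < (x / A).toNNReal from
      Real.lt_toNNReal_iff_coe_lt.2 (not_le.1 hlt))
  refine (Real.lt_toNNReal_iff_coe_lt.1 hy).not_ge ?_
  rw [div_le_iff₀' hA]
  exact h _ (pack_closureMatrix hG w T τ H fun a ha b hb =>
    reachable_of_connected_coe hH.connected (hTH ha) (hTH hb))

end Graphs

/-! ### Program variables and a program logic with step bounds -/

/-- The variables of the spanner program. -/
structure Vars : Type where
  n : ℕ
  k : ℕ
  a : ℕ
  b : ℕ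
  i : ℕ
  c : ℕ
  e : ℕ
  m : ℕ
  net : ℕ → ℕ
  dead : ℕ → ℕ
  ε : ℝ
  S : ℝ
  w : ℝ
  δ : ℝ
  W : ℝ
  β : ℝ
  out : List (ℕ × ℕ)

namespace Vars

/-- Layout of the natural variables in memory. -/
def natMem (x : Vars) : ℕ → ℕ → ℕ
  | 0, 0 => x.n
  | 0, 1 => x.k
  | 0, 2 => x.a
  | 0, 3 => x.b
  | 0, 4 => x.i
  | 0, 5 => x.c
  | 0, 6 => x.e
  | 0, 7 => x.m
  | 1, u => x.net u
  | 2, u => x.dead u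
  | _, _ => 0

/-- Layout of the real variables in memory. -/
def realMem (x : Vars) : ℕ → ℕ → ℝ
  | 0, 0 => x.ε
  | 0, 1 => x.S
  | 0, 2 => x.w
  | 0, 3 => x.δ
  | 0, 4 => x.W
  | 0, 5 => x.β
  | _, _ => 0

/-- The machine state given by the values of the variables. -/
def toState (x : Vars) : State := ⟨x.natMem, x.realMem, x.out⟩

/-- The values of the variables in the initial state. -/
def start (n k : ℕ) (ε : ℝ) : Vars where
  n := n
  k := k
  a := 0
  b := 0
  i := 0
  c := 0
  e := 0
  m := 0
  net := fun _ => 0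
  dead := fun _ => 0
  ε := ε
  S := 0
  w := 0
  δ := 0
  W := 0
  β := 0
  out := []

theorem write_scalar {α : Type} {f g : ℕ → ℕ → α} {r : ℕ} {v : α} (h0 : g 0 r = v)
    (h : ∀ i, i ≠ r → g 0 i = f 0 i) (h' : ∀ a i, g (a + 1) i = f (a + 1) i) :
    write f 0 r v = g := by
  funext a i
  rcases a with _ | a
  · by_cases hi : i = r
    · subst hi; simp [write, h0]
    · simp [write, hi, h i hi]
  · simp [write, h']

theorem start_toState (n k : ℕ) (ε : ℝ) : (start n k ε).toState = initState n k ε := by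
  have h1 : write (write (fun _ _ => 0) 0 0 n) 0 1 k = (start n k ε).natMem := by
    refine write_scalar rfl (fun i hi => ?_) fun a i => ?_
    · rcases i with _ | _ | _ | _ | _ | _ | _ | _ | i <;> first | rfl | exact absurd rfl hi
    · rcases a with _ | _ | a <;> rfl
  have h2 : write (fun _ _ => 0) 0 0 ε = (start n k ε).realMem := by
    refine write_scalar rfl (fun i hi => ?_) fun a i => rfl
    rcases i with _ | _ | _ | _ | _ | _ | i <;> first | rfl | exact absurd rfl hi
  rw [initState, h1, h2]
  rfl

theorem write_a (x : Vars) (v : ℕ) :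
    { x.toState with nmem := write x.toState.nmem 0 2 v } = { x with a := v }.toState := by
  refine congrArg (fun f => State.mk f x.realMem x.out) (write_scalar rfl (fun i hi => ?_) ?_)
  · rcases i with _ | _ | _ | _ | _ | _ | _ | _ | i <;> first | rfl | exact absurd rfl hi
  · rintro (_ | _ | a) i <;> rfl

theorem write_b (x : Vars) (v : ℕ) :
    { x.toState with nmem := write x.toState.nmem 0 3 v } = { x with b := v }.toState := by
  refine congrArg (fun f => State.mk f x.realMem x.out) (write_scalar rfl (fun i hi => ?_) ?_)
  · rcases i with _ | _ | _ | _ | _ | _ | _ | _ | i <;> first | rfl | exact absurd rfl hi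
  · rintro (_ | _ | a) i <;> rfl

theorem write_i (x : Vars) (v : ℕ) :
    { x.toState with nmem := write x.toState.nmem 0 4 v } = { x with i := v }.toState := by
  refine congrArg (fun f => State.mk f x.realMem x.out) (write_scalar rfl (fun i hi => ?_) ?_)
  · rcases i with _ | _ | _ | _ | _ | _ | _ | _ | i <;> first | rfl | exact absurd rfl hi
  · rintro (_ | _ | a) i <;> rfl

theorem write_c (x : Vars) (v : ℕ) :
    { x.toState with nmem := write x.toState.nmem 0 5 v } = { x with c := v }.toState := by
  refine congrArg (fun f => State.mk f x.realMem x.out) (write_scalar rfl (fun i hi => ?_) ?_)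
  · rcases i with _ | _ | _ | _ | _ | _ | _ | _ | i <;> first | rfl | exact absurd rfl hi
  · rintro (_ | _ | a) i <;> rfl

theorem write_e (x : Vars) (v : ℕ) :
    { x.toState with nmem := write x.toState.nmem 0 6 v } = { x with e := v }.toState := by
  refine congrArg (fun f => State.mk f x.realMem x.out) (write_scalar rfl (fun i hi => ?_) ?_)
  · rcases i with _ | _ | _ | _ | _ | _ | _ | _ | i <;> first | rfl | exact absurd rfl hi
  · rintro (_ | _ | a) i <;> rfl

theorem write_m (x : Vars) (v : ℕ) :
    { x.toState with nmem := write x.toState.nmem 0 7 v } = { x with m := v }.toState := by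
  refine congrArg (fun f => State.mk f x.realMem x.out) (write_scalar rfl (fun i hi => ?_) ?_)
  · rcases i with _ | _ | _ | _ | _ | _ | _ | _ | i <;> first | rfl | exact absurd rfl hi
  · rintro (_ | _ | a) i <;> rfl

theorem write_net (x : Vars) (u v : ℕ) :
    { x.toState with nmem := write x.toState.nmem 1 u v } =
      { x with net := Function.update x.net u v }.toState := by
  refine congrArg (fun f => State.mk f x.realMem x.out) ?_
  funext a i
  rcases a with _ | _ | _ | a
  · rcases i with _ | _ | _ | _ | _ | _ | _ | _ | i <;> rfl
  all_goals rfl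

theorem write_dead (x : Vars) (u v : ℕ) :
    { x.toState with nmem := write x.toState.nmem 2 u v } =
      { x with dead := Function.update x.dead u v }.toState := by
  refine congrArg (fun f => State.mk f x.realMem x.out) ?_
  funext a i
  rcases a with _ | _ | _ | a
  · rcases i with _ | _ | _ | _ | _ | _ | _ | _ | i <;> rfl
  all_goals rfl

theorem write_S (x : Vars) (v : ℝ) :
    { x.toState with rmem := write x.toState.rmem 0 1 v } = { x with S := v }.toState := by
  refine congrArg (fun f => State.mk x.natMem f x.out)
    (write_scalar rfl (fun i hi => ?_) fun a i => rfl)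
  rcases i with _ | _ | _ | _ | _ | _ | i <;> first | rfl | exact absurd rfl hi

theorem write_w (x : Vars) (v : ℝ) :
    { x.toState with rmem := write x.toState.rmem 0 2 v } = { x with w := v }.toState := by
  refine congrArg (fun f => State.mk x.natMem f x.out)
    (write_scalar rfl (fun i hi => ?_) fun a i => rfl)
  rcases i with _ | _ | _ | _ | _ | _ | i <;> first | rfl | exact absurd rfl hi

theorem write_δ (x : Vars) (v : ℝ) :
    { x.toState with rmem := write x.toState.rmem 0 3 v } = { x with δ := v }.toState := by
  refine congrArg (fun f => State.mk x.natMem f x.out)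
    (write_scalar rfl (fun i hi => ?_) fun a i => rfl)
  rcases i with _ | _ | _ | _ | _ | _ | i <;> first | rfl | exact absurd rfl hi

theorem write_W (x : Vars) (v : ℝ) :
    { x.toState with rmem := write x.toState.rmem 0 4 v } = { x with W := v }.toState := by
  refine congrArg (fun f => State.mk x.natMem f x.out)
    (write_scalar rfl (fun i hi => ?_) fun a i => rfl)
  rcases i with _ | _ | _ | _ | _ | _ | i <;> first | rfl | exact absurd rfl hi

theorem write_β (x : Vars) (v : ℝ) :
    { x.toState with rmem := write x.toState.rmem 0 5 v } = { x with β := v }.toState := by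
  refine congrArg (fun f => State.mk x.natMem f x.out)
    (write_scalar rfl (fun i hi => ?_) fun a i => rfl)
  rcases i with _ | _ | _ | _ | _ | _ | i <;> first | rfl | exact absurd rfl hi

end Vars

/-- Started with the variables `x`, the program halts within `K` steps with variables that
satisfy `Q`. -/
def Runs (D : ℕ → ℕ → ℝ) (p : Prog) (x : Vars) (K : ℕ) (Q : Vars → Prop) : Prop :=
  ∃ c y, Exec D p x.toState c (Vars.toState y) ∧ c ≤ K ∧ Q y

section Rules

variable {D : ℕ → ℕ → ℝ} {x : Vars} {Q Q' : Vars → Prop} {p q : Prog} {K K' : ℕ}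

theorem Runs.mono (h : Runs D p x K Q) (hK : K ≤ K') (hQ : ∀ y, Q y → Q' y) :
    Runs D p x K' Q' := by
  obtain ⟨c, y, h1, h2, h3⟩ := h
  exact ⟨c, y, h1, h2.trans hK, hQ y h3⟩

theorem runs_skip (h : Q x) : Runs D .skip x 1 Q := ⟨1, x, .skip _, le_rfl, h⟩

theorem runs_emit {i j : NExp}
    (h : Q { x with out := x.out ++ [(i.eval x.toState, j.eval x.toState)] }) :
    Runs D (.emit i j) x 1 Q :=
  ⟨1, _, .emit i j _, le_rfl, h⟩

theorem runs_nset {a : ℕ} {i e : NExp} (y : Vars)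
    (hy : { x.toState with
      nmem := write x.toState.nmem a (i.eval x.toState) (e.eval x.toState) } = y.toState)
    (h : Q y) : Runs D (.nset a i e) x 1 Q :=
  ⟨1, y, hy ▸ .nset a i e _, le_rfl, h⟩

theorem runs_rset {a : ℕ} {i : NExp} {e : RExp} (y : Vars)
    (hy : { x.toState with
      rmem := write x.toState.rmem a (i.eval x.toState) (e.eval D x.toState) } = y.toState)
    (h : Q y) : Runs D (.rset a i e) x 1 Q :=
  ⟨1, y, hy ▸ .rset a i e _, le_rfl, h⟩

theorem Runs.seq (h : Runs D p x K fun y => Runs D q y K' Q) :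
    Runs D (.seq p q) x (K + K') Q := by
  obtain ⟨c, y, h1, h2, c', z, h3, h4, h5⟩ := h
  exact ⟨_, z, .seq h1 h3, add_le_add h2 h4, h5⟩

theorem runs_ite {b : BExp} (h1 : b.holds D x.toState → Runs D p x K Q)
    (h2 : ¬ b.holds D x.toState → Runs D q x K Q) : Runs D (.ite b p q) x (K + 1) Q := by
  by_cases hb : b.holds D x.toState
  · obtain ⟨c, y, h, hc, hQ⟩ := h1 hb
    exact ⟨_, y, .ite_true hb h, by omega, hQ⟩
  · obtain ⟨c, y, h, hc, hQ⟩ := h2 hb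
    exact ⟨_, y, .ite_false hb h, by omega, hQ⟩

/-- The index j counts completed iterations. That a true test forces j < M gives both termination
and the step bound. -/
theorem runs_loop {b : BExp} (I : ℕ → Vars → Prop) (M : ℕ) (h0 : I 0 x)
    (step : ∀ j y, I j y → b.holds D y.toState → j < M ∧ Runs D p y K (I (j + 1))) :
    Runs D (.loop b p) x (M * (K + 1) + 1)
      fun y => ¬ b.holds D y.toState ∧ ∃ j, I j y := by
  have main : ∀ r j y, I j y → j + r = M → Runs D (.loop b p) y (r * (K + 1) + 1)
      fun y => ¬ b.holds D y.toState ∧ ∃ j, I j y := by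
    intro r
    induction r with
    | zero =>
      intro j y hy hj
      have hb : ¬ b.holds D y.toState := fun hb => by
        have := (step j y hy hb).1
        omega
      exact ⟨1, y, .loop_false hb, by omega, hb, j, hy⟩
    | succ r ih =>
      intro j y hy hj
      by_cases hb : b.holds D y.toState
      · obtain ⟨c, z, hz, hc, hI⟩ := (step j y hy hb).2
        obtain ⟨c', z', hz', hc', hI'⟩ := ih (j + 1) z hI (by omega)
        refine ⟨_, z', .loop_true hb hz hz', ?_, hI'⟩
        rw [Nat.succ_mul]
        omega
      · exact ⟨1, y, .loop_false hb, by omega, hb, j, hy⟩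
  exact main M 0 x h0 (by omega)

/-- The natural variable in cell `r` of the array `0`. -/
abbrev reg (r : ℕ) : NExp := .get 0 (.lit r)

/-- The real variable in cell `r` of the array `0`. -/
abbrev rreg (r : ℕ) : RExp := .get 0 (.lit r)

/-- Execute `body` for the values `0, …, bound - 1` of the variable in cell `r`. -/
def forLoop (r : ℕ) (bound : NExp) (body : Prog) : Prog :=
  .seq (.nset 0 (.lit r) (.lit 0))
    (.loop (.nlt (reg r) bound) (.seq body (.nset 0 (.lit r) (.add (reg r) (.lit 1)))))

/-- The invariant pins the counter and the value of the bound, so a body that preserves it cannot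
disturb them. Adding j ≤ M to it identifies the exit index as exactly M. `set` abstracts over the
choice of the counter variable. -/
theorem runs_forLoop {r : ℕ} {bound : NExp} {body : Prog} (set : Vars → ℕ → Vars)
    (hset : ∀ (x : Vars) v,
      { x.toState with nmem := write x.toState.nmem 0 r v } = (set x v).toState)
    (I : ℕ → Vars → Prop) (M : ℕ)
    (hI : ∀ j y, I j y → y.toState.nmem 0 r = j ∧ bound.eval y.toState = M)
    (h0 : I 0 (set x 0))
    (step : ∀ j y, j < M → I j y →
      Runs D body y K fun z => I (j + 1) (set z (z.toState.nmem 0 r + 1))) :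
    Runs D (forLoop r bound body) x (M * (K + 2) + 2) (I M) := by
  refine (Runs.seq (K := 1) (K' := M * (K + 1 + 1) + 1) (runs_nset _ (hset x 0)
    ((runs_loop (fun j y => I j y ∧ j ≤ M) M ⟨h0, Nat.zero_le _⟩ ?_).mono le_rfl ?_))).mono
    (by rw [add_assoc K 1 1, add_comm 1, add_assoc]) fun y hy => hy
  · rintro j y ⟨hy, -⟩ hb
    have hj : j < M := by
      have := hI j y hy
      simpa [BExp.holds, NExp.eval, this.1, this.2] using hb
    refine ⟨hj, Runs.seq ((step j y hj hy).mono le_rfl fun z hz => ?_)⟩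
    exact runs_nset _ (hset z _) ⟨hz, hj⟩
  · rintro y ⟨hb, j, hy, hj⟩
    have := hI j y hy
    have hM : ¬ j < M := by simpa [BExp.holds, NExp.eval, this.1, this.2] using hb
    obtain rfl : j = M := by omega
    exact hy

theorem runs_forLoop_a {bound : NExp} {body : Prog} (I : ℕ → Vars → Prop) (M : ℕ)
    (hI : ∀ j y, I j y → y.a = j ∧ bound.eval y.toState = M) (h0 : I 0 { x with a := 0 })
    (step : ∀ j y, j < M → I j y →
      Runs D body y K fun z => I (j + 1) { z with a := z.a + 1 }) :
    Runs D (forLoop 2 bound body) x (M * (K + 2) + 2) (I M) :=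
  runs_forLoop (fun x v => { x with a := v }) Vars.write_a I M hI h0 step

theorem runs_forLoop_b {bound : NExp} {body : Prog} (I : ℕ → Vars → Prop) (M : ℕ)
    (hI : ∀ j y, I j y → y.b = j ∧ bound.eval y.toState = M) (h0 : I 0 { x with b := 0 })
    (step : ∀ j y, j < M → I j y →
      Runs D body y K fun z => I (j + 1) { z with b := z.b + 1 }) :
    Runs D (forLoop 3 bound body) x (M * (K + 2) + 2) (I M) :=
  runs_forLoop (fun x v => { x with b := v }) Vars.write_b I M hI h0 step

theorem runs_forLoop_i {bound : NExp} {body : Prog} (I : ℕ → Vars → Prop) (M : ℕ)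
    (hI : ∀ j y, I j y → y.i = j ∧ bound.eval y.toState = M) (h0 : I 0 { x with i := 0 })
    (step : ∀ j y, j < M → I j y →
      Runs D body y K fun z => I (j + 1) { z with i := z.i + 1 }) :
    Runs D (forLoop 4 bound body) x (M * (K + 2) + 2) (I M) :=
  runs_forLoop (fun x v => { x with i := v }) Vars.write_i I M hI h0 step

end Rules

/-! ### The spanner program -/

/-- Sum of the first row of the input. -/
def sumProg : Prog :=
  forLoop 2 (reg 0) (.rset 0 (.lit 1) (.add (rreg 1) (.input (.lit 0) (reg 2))))

/-- Emit all edges of weight at most `w`. -/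
def lightProg : Prog :=
  forLoop 2 (reg 0) (forLoop 3 (reg 0)
    (.ite (.rlt (rreg 2) (.input (reg 2) (reg 3))) .skip (.emit (reg 2) (reg 3))))

/-- Mark exactly the points outside the net as dead. -/
def resetProg : Prog :=
  forLoop 2 (reg 0) (.nset 2 (reg 2) (.get 1 (reg 2)))

/-- Execute `p` if the distance between the points `a` and `b` is at most `x * W`. -/
def ifNear (x : NExp) (p : Prog) : Prog :=
  .ite (.rlt (.mul (.ofNat x) (rreg 4)) (.input (reg 2) (reg 3))) .skip p

/-- Count the points alive in the balls of radius `i * W` and `(i + 1) * W` around `a`. -/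
def countProg : Prog :=
  .seq (.nset 0 (.lit 5) (.lit 0)) (.seq (.nset 0 (.lit 6) (.lit 0))
    (forLoop 3 (reg 0) (.ite (.nlt (.lit 0) (.get 2 (reg 3))) .skip
      (.seq (ifNear (reg 4) (.nset 0 (.lit 5) (.add (reg 5) (.lit 1))))
        (ifNear (.add (reg 4) (.lit 1)) (.nset 0 (.lit 6) (.add (reg 6) (.lit 1))))))))

/-- Choose the index `m < k` for which the ball around `a` grows least. -/
def chooseProg : Prog :=
  .seq (.nset 0 (.lit 7) (.lit 0)) (.seq (.rset 0 (.lit 5) (.ofNat (reg 0)))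
    (forLoop 4 (reg 1) (.seq countProg
      (.ite (.rlt (.div (.ofNat (reg 6)) (.ofNat (reg 5))) (rreg 5))
        (.seq (.rset 0 (.lit 5) (.div (.ofNat (reg 6)) (.ofNat (reg 5))))
          (.nset 0 (.lit 7) (reg 4))) .skip))))

/-- Join `a` to the points alive in the ball of radius `(m + 1) * W`, and kill those in the
ball of radius `m * W`. -/
def killProg : Prog :=
  forLoop 3 (reg 0) (.ite (.nlt (.lit 0) (.get 2 (reg 3))) .skip
    (.seq (ifNear (.add (reg 7) (.lit 1)) (.emit (reg 2) (reg 3)))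
      (ifNear (reg 7) (.nset 2 (reg 3) (.lit 1)))))

/-- Ball growing around all points that are alive. -/
def ballsProg : Prog :=
  forLoop 2 (reg 0) (.ite (.nlt (.lit 0) (.get 2 (reg 2))) .skip (.seq chooseProg killProg))

/-- Thin out the net to mutual distances above `δ * δ * w`. -/
def netProg : Prog :=
  forLoop 2 (reg 0) (.ite (.nlt (.lit 0) (.get 1 (reg 2))) .skip
    (forLoop 3 (reg 0) (.ite (.and (.nlt (reg 2) (reg 3)) (.and
      (.not (.nlt (.lit 0) (.get 1 (reg 3))))
      (.not (.rlt (.mul (.mul (rreg 3) (rreg 3)) (rreg 2)) (.input (reg 2) (reg 3))))))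
      (.seq (.emit (reg 2) (reg 3)) (.nset 1 (reg 3) (.lit 1))) .skip)))

/-- Treat the distances between `w` and `(1 + δ) * w`. -/
def scaleProg : Prog :=
  .seq (.rset 0 (.lit 4)
      (.mul (.add (.ofNat (.lit 1)) (.mul (.ofNat (.lit 3)) (rreg 3))) (rreg 2)))
    (.seq resetProg (.seq ballsProg (.seq netProg
      (.rset 0 (.lit 2) (.mul (rreg 2) (.add (.ofNat (.lit 1)) (rreg 3)))))))

/-- The spanner subroutine. -/
def spannerProg : Prog :=
  .seq sumProg (.seq (.rset 0 (.lit 2) (.div (rreg 1)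
      (.mul (.mul (.ofNat (reg 0)) (.ofNat (reg 0))) (.ofNat (reg 0)))))
    (.seq (.rset 0 (.lit 3) (.div (rreg 0)
        (.add (.ofNat (.lit 5)) (.mul (.ofNat (.lit 5)) (rreg 0)))))
      (.seq lightProg (.loop (.rlt (rreg 2) (rreg 1)) scaleProg))))

/-! ### Correctness of the parts of the program -/

theorem Runs.le {D : ℕ → ℕ → ℝ} {p : Prog} {x : Vars} {K K' : ℕ} {Q : Vars → Prop}
    (h : Runs D p x K Q) (hK : K ≤ K') : Runs D p x K' Q := h.mono hK fun _ h => h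

theorem listWeight_concat (D : ℕ → ℕ → ℝ) (o : List (ℕ × ℕ)) (a b : ℕ) :
    listWeight D (o ++ [(a, b)]) = listWeight D o + D a b := by
  simp [listWeight]

theorem Reach.mono {D : ℕ → ℕ → ℝ} {n : ℕ} {o o' : List (ℕ × ℕ)} {i j : ℕ} {ℓ ℓ' : ℝ}
    (h : Reach D n o i j ℓ) (ho : o ⊆ o') (hℓ : ℓ ≤ ℓ') : Reach D n o' i j ℓ' := by
  induction h generalizing ℓ' with
  | refl h h' => exact .refl h (h'.trans hℓ)
  | edge h h' hm hd => exact .edge h h' (ho hm) (hd.trans hℓ)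
  | symm _ ih => exact (ih hℓ).symm
  | @trans i j l ℓ m _ _ ih ih' =>
    have := (ih le_rfl).trans (ih' (ℓ' := ℓ' - ℓ) (by linarith))
    rwa [add_sub_cancel] at this

theorem Reach.dist_le {D : ℕ → ℕ → ℝ} {n : ℕ} (hD : IsMetric D n) {o : List (ℕ × ℕ)}
    {i j : ℕ} {ℓ : ℝ} (h : Reach D n o i j ℓ) : D i j ≤ ℓ := by
  induction h with
  | refl _ h => rwa [hD.self]
  | edge _ _ _ h => exact h
  | symm _ ih => rwa [hD.symm]
  | trans h h' ih ih' =>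
    exact (hD.triangle _ _ _ h.lt.1 h.lt.2 h'.lt.2).trans (add_le_add ih ih')

theorem runs_sumProg (D : ℕ → ℕ → ℝ) (x : Vars) :
    Runs D sumProg x (x.n * 3 + 2)
      fun y => y = { x with a := x.n, S := x.S + ∑ i ∈ Finset.range x.n, D 0 i } := by
  refine runs_forLoop_a
    (fun j y => y = { x with a := j, S := x.S + ∑ i ∈ Finset.range j, D 0 i }) x.n ?_ ?_ ?_
  · rintro j y rfl
    exact ⟨rfl, rfl⟩
  · simp
  · rintro j y hj rfl
    refine runs_rset _ (Vars.write_S _ _) ?_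
    simp only [Finset.sum_range_succ, ← add_assoc]
    rfl

theorem runs_lightProg (D : ℕ → ℕ → ℝ) (x : Vars) (hw : 0 ≤ x.w) (hout : x.out = []) :
    Runs D lightProg x (x.n * (x.n * 4 + 4) + 2) fun y => ∃ a b o,
      y = { x with a := a, b := b, out := o } ∧
      (∀ p < x.n, ∀ q < x.n, D p q ≤ x.w → (p, q) ∈ o) ∧
      listWeight D o ≤ x.n * x.n * x.w := by
  refine (runs_forLoop_a (fun j y => ∃ b o, y = { x with a := j, b := b, out := o } ∧
      (∀ p < j, ∀ q < x.n, D p q ≤ x.w → (p, q) ∈ o) ∧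
      listWeight D o ≤ j * x.n * x.w) x.n ?_ ?_ ?_).mono le_rfl ?_
  · rintro j y ⟨b, o, rfl, -⟩
    exact ⟨rfl, rfl⟩
  · exact ⟨x.b, x.out, rfl, by simp, by simp [hout, listWeight]⟩
  · rintro j y hj ⟨b, o, rfl, ho, hwt⟩
    refine (runs_forLoop_b (K := 2)
      (fun l y => ∃ o, y = { x with a := j, b := l, out := o } ∧
        (∀ p < j, ∀ q < x.n, D p q ≤ x.w → (p, q) ∈ o) ∧
        (∀ q < l, D j q ≤ x.w → (j, q) ∈ o) ∧
        listWeight D o ≤ j * x.n * x.w + l * x.w) x.n ?_ ?_ ?_).mono le_rfl ?_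
    · rintro l y ⟨o, rfl, -⟩
      exact ⟨rfl, rfl⟩
    · exact ⟨o, rfl, ho, by simp, by simpa using hwt⟩
    · rintro l y hl ⟨o, rfl, ho, ho', hwt⟩
      refine runs_ite (fun hb => runs_skip ?_) fun hb => runs_emit ?_
      · have hb : x.w < D j l := hb
        refine ⟨o, rfl, ho, fun q hq hd => ?_, hwt.trans (by push_cast; nlinarith)⟩
        rcases Nat.lt_succ_iff_lt_or_eq.1 hq with hq | rfl
        · exact ho' q hq hd
        · exact absurd hd hb.not_ge
      · have hb : ¬ x.w < D j l := hb
        refine ⟨o ++ [(j, l)], rfl, fun p hp q hq hd =>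
          List.mem_append_left _ (ho p hp q hq hd), fun q hq hd => ?_, ?_⟩
        · rcases Nat.lt_succ_iff_lt_or_eq.1 hq with hq | rfl
          · exact List.mem_append_left _ (ho' q hq hd)
          · simp
        · rw [listWeight_concat]
          push_cast
          linarith
    · rintro y ⟨o, rfl, ho, ho', hwt⟩
      refine ⟨x.n, o, rfl, fun p hp q hq hd => ?_, hwt.trans (by push_cast; linarith)⟩
      rcases Nat.lt_succ_iff_lt_or_eq.1 hp with hp | rfl
      · exact ho p hp q hq hd
      · exact ho' q hq hd
  · rintro y ⟨b, o, rfl, h⟩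
    exact ⟨x.n, b, o, rfl, h⟩

theorem runs_resetProg (D : ℕ → ℕ → ℝ) (x : Vars) :
    Runs D resetProg x (x.n * 3 + 2) fun y => ∃ f,
      y = { x with a := x.n, dead := f } ∧ ∀ u < x.n, f u = x.net u := by
  refine runs_forLoop_a (fun j y => ∃ f, y = { x with a := j, dead := f } ∧
    ∀ u < j, f u = x.net u) x.n ?_ ⟨_, rfl, by simp⟩ ?_
  · rintro j y ⟨f, rfl, -⟩
    exact ⟨rfl, rfl⟩
  · rintro j y hj ⟨f, rfl, hf⟩
    refine runs_nset _ (Vars.write_dead _ _ _) ⟨_, rfl, fun u hu => ?_⟩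
    change Function.update f j (x.net j) u = x.net u
    by_cases h : u = j
    · subst h; simp
    · rw [Function.update_of_ne h, hf u (by omega)]

/-- The points below `n` at which `f` vanishes. -/
def zeros (n : ℕ) (f : ℕ → ℕ) : Finset ℕ := (Finset.range n).filter fun u => f u = 0

theorem mem_zeros {n : ℕ} {f : ℕ → ℕ} {u : ℕ} : u ∈ zeros n f ↔ u < n ∧ f u = 0 := by
  simp [zeros]

theorem card_zeros_le (n : ℕ) (f : ℕ → ℕ) : (zeros n f).card ≤ n :=
  (Finset.card_filter_le _ _).trans (Finset.card_range n).le

open Classical in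
/-- The points alive in the ball of radius `ρ` around `v`. -/
noncomputable def ball (D : ℕ → ℕ → ℝ) (f : ℕ → ℕ) (n v : ℕ) (ρ : ℝ) : Finset ℕ :=
  (Finset.range n).filter fun u => f u = 0 ∧ D v u ≤ ρ

theorem mem_ball {D : ℕ → ℕ → ℝ} {f : ℕ → ℕ} {n v : ℕ} {ρ : ℝ} {u : ℕ} :
    u ∈ ball D f n v ρ ↔ u < n ∧ f u = 0 ∧ D v u ≤ ρ := by
  simp [ball]

theorem ball_succ_of_pos {D : ℕ → ℕ → ℝ} {f : ℕ → ℕ} {n v : ℕ} {ρ : ℝ}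
    (h : f n = 0 ∧ D v n ≤ ρ) : ball D f (n + 1) v ρ = insert n (ball D f n v ρ) := by
  rw [ball, Finset.range_add_one, Finset.filter_insert, if_pos h]
  rfl

theorem ball_succ_of_neg {D : ℕ → ℕ → ℝ} {f : ℕ → ℕ} {n v : ℕ} {ρ : ℝ}
    (h : ¬ (f n = 0 ∧ D v n ≤ ρ)) : ball D f (n + 1) v ρ = ball D f n v ρ := by
  rw [ball, Finset.range_add_one, Finset.filter_insert, if_neg h]
  rfl

theorem notMem_ball_self (D : ℕ → ℕ → ℝ) (f : ℕ → ℕ) (n v : ℕ) (ρ : ℝ) :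
    n ∉ ball D f n v ρ := by
  simp [mem_ball]

theorem card_ball_succ_of_pos {D : ℕ → ℕ → ℝ} {f : ℕ → ℕ} {n v : ℕ} {ρ : ℝ}
    (h : f n = 0 ∧ D v n ≤ ρ) : (ball D f (n + 1) v ρ).card = (ball D f n v ρ).card + 1 := by
  rw [ball_succ_of_pos h, Finset.card_insert_of_notMem (notMem_ball_self D f n v ρ)]

theorem ball_mono (D : ℕ → ℕ → ℝ) (f : ℕ → ℕ) (n v : ℕ) {ρ ρ' : ℝ} (h : ρ ≤ ρ') :
    ball D f n v ρ ⊆ ball D f n v ρ' := fun u hu => by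
  rw [mem_ball] at hu ⊢
  exact ⟨hu.1, hu.2.1, hu.2.2.trans h⟩

theorem ball_subset_zeros (D : ℕ → ℕ → ℝ) (f : ℕ → ℕ) (n v : ℕ) (ρ : ℝ) :
    ball D f n v ρ ⊆ zeros n f := fun u hu => by
  rw [mem_ball] at hu
  exact mem_zeros.2 ⟨hu.1, hu.2.1⟩

/-- Size of the ball of radius `i * W` around `a`. -/
noncomputable def Vars.size (D : ℕ → ℕ → ℝ) (x : Vars) (i : ℕ) : ℕ :=
  (ball D x.dead x.n x.a (i * x.W)).card

theorem runs_countProg (D : ℕ → ℕ → ℝ) (x : Vars) :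
    Runs D countProg x (x.n * 7 + 4) fun y => ∃ b,
      y = { x with b := b, c := x.size D x.i, e := x.size D (x.i + 1) } := by
  refine Runs.le (Runs.seq (K := 1) (K' := 1 + (x.n * (5 + 2) + 2)) (runs_nset _
    (Vars.write_c _ _) (Runs.seq (runs_nset _ (Vars.write_e _ _) ?_)))) (by omega)
  refine (runs_forLoop_b (fun j y => y = { x with
    b := j
    c := (ball D x.dead j x.a (x.i * x.W)).card
    e := (ball D x.dead j x.a ((x.i + 1 : ℕ) * x.W)).card }) x.n ?_ ?_ ?_).mono le_rfl ?_
  · rintro j y rfl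
    exact ⟨rfl, rfl⟩
  · simp [ball, NExp.eval]
  · rintro j y hj rfl
    refine runs_ite (fun hb => (runs_skip ?_).le (by omega)) fun hb => ?_
    · have hb : 0 < x.dead j := hb
      rw [ball_succ_of_neg fun h => hb.ne' h.1, ball_succ_of_neg fun h => hb.ne' h.1]
    · have hb : ¬ 0 < x.dead j := hb
      have h0 : x.dead j = 0 := by omega
      refine Runs.seq (K := 2) (K' := 2) (runs_ite (fun h1 => runs_skip (runs_ite (fun h2 =>
        runs_skip ?_) fun h2 => runs_nset _ (Vars.write_e _ _) ?_)) fun h1 => runs_nset _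
        (Vars.write_c _ _) (runs_ite (fun h2 => runs_skip ?_) fun h2 => runs_nset _
        (Vars.write_e _ _) ?_))
      · have h1 : x.i * x.W < D x.a j := h1
        have h2 : (x.i + 1 : ℕ) * x.W < D x.a j := h2
        rw [ball_succ_of_neg fun h => h1.not_ge h.2, ball_succ_of_neg fun h => h2.not_ge h.2]
      · have h1 : x.i * x.W < D x.a j := h1
        have h2 : ¬ (x.i + 1 : ℕ) * x.W < D x.a j := h2
        rw [ball_succ_of_neg fun h => h1.not_ge h.2, card_ball_succ_of_pos ⟨h0, not_lt.1 h2⟩]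
        rfl
      · have h1 : ¬ x.i * x.W < D x.a j := h1
        have h2 : (x.i + 1 : ℕ) * x.W < D x.a j := h2
        rw [card_ball_succ_of_pos ⟨h0, not_lt.1 h1⟩, ball_succ_of_neg fun h => h2.not_ge h.2]
        rfl
      · have h1 : ¬ x.i * x.W < D x.a j := h1
        have h2 : ¬ (x.i + 1 : ℕ) * x.W < D x.a j := h2
        rw [card_ball_succ_of_pos ⟨h0, not_lt.1 h1⟩, card_ball_succ_of_pos ⟨h0, not_lt.1 h2⟩]
        rfl
  · rintro y rfl
    exact ⟨_, rfl⟩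

/-- The growth of the ball around `a` from radius `i * W` to radius `(i + 1) * W`. -/
noncomputable def Vars.ratio (D : ℕ → ℕ → ℝ) (x : Vars) (i : ℕ) : ℝ :=
  (x.size D (i + 1) : ℝ) / x.size D i

theorem one_le_size {D : ℕ → ℕ → ℝ} (hD : ∀ i, D i i = 0) {x : Vars} (hW : 0 ≤ x.W)
    (ha : x.a < x.n) (h0 : x.dead x.a = 0) (i : ℕ) : 1 ≤ x.size D i :=
  Finset.card_pos.2 ⟨x.a, mem_ball.2 ⟨ha, h0, by rw [hD]; positivity⟩⟩

theorem size_le_card_zeros (D : ℕ → ℕ → ℝ) (x : Vars) (i : ℕ) :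
    x.size D i ≤ (zeros x.n x.dead).card :=
  Finset.card_le_card (ball_subset_zeros _ _ _ _ _)

theorem runs_chooseProg {D : ℕ → ℕ → ℝ} (hD : ∀ i, D i i = 0) (x : Vars) (hW : 0 ≤ x.W)
    (hk : 0 < x.k) (ha : x.a < x.n) (h0 : x.dead x.a = 0) :
    Runs D chooseProg x (x.k * (x.n * 7 + 9) + 4) fun y => ∃ b i c e m β,
      y = { x with b := b, i := i, c := c, e := e, m := m, β := β } ∧ m < x.k ∧
      ∀ i < x.k, x.ratio D m ≤ x.ratio D i := by
  refine Runs.le (Runs.seq (K := 1) (K' := 1 + (x.k * (x.n * 7 + 4 + 3 + 2) + 2)) (runs_nset _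
    (Vars.write_m _ _) (Runs.seq (runs_rset _ (Vars.write_β _ _) ?_))))
    (by rw [show x.n * 7 + 4 + 3 + 2 = x.n * 7 + 9 by omega]; omega)
  refine (runs_forLoop_i (fun j y => ∃ b c e m β,
      y = { x with b := b, i := j, c := c, e := e, m := m, β := β } ∧ m < x.k ∧
      x.ratio D m ≤ β ∧ ∀ i < j, β ≤ x.ratio D i) x.k ?_ ?_ ?_).mono le_rfl ?_
  · rintro j y ⟨b, c, e, m, β, rfl, -⟩
    exact ⟨rfl, rfl⟩
  -- The start value n of β bounds the ratio at index 0, because the smaller ball contains the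
  -- centre and the larger has at most n points.
  · refine ⟨x.b, x.c, x.e, 0, x.n, rfl, hk, ?_, by simp⟩
    refine (div_le_self (by positivity) (Nat.one_le_cast.2 (one_le_size hD hW ha h0 0))).trans ?_
    exact_mod_cast (size_le_card_zeros D x 1).trans (card_zeros_le _ _)
  · rintro j y hj ⟨b, c, e, m, β, rfl, hm, hmβ, hβ⟩
    refine Runs.seq (K := x.n * 7 + 4) (K' := 3) ((runs_countProg D _).mono le_rfl ?_)
    rintro y ⟨b', rfl⟩
    refine runs_ite (fun hb => ?_) fun hb => (runs_skip ?_).le (by omega)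
    · have hb : x.ratio D j < β := hb
      refine Runs.seq (K := 1) (K' := 1) (runs_rset _ (Vars.write_β _ _)
        (runs_nset _ (Vars.write_m _ _) ?_))
      refine ⟨b', x.size D j, x.size D (j + 1), j, x.ratio D j, rfl, hj, le_rfl, fun i hi => ?_⟩
      rcases Nat.lt_succ_iff_lt_or_eq.1 hi with hi | rfl
      · exact hb.le.trans (hβ i hi)
      · exact le_rfl
    · have hb : ¬ x.ratio D j < β := hb
      refine ⟨b', x.size D j, x.size D (j + 1), m, β, rfl, hm, hmβ, fun i hi => ?_⟩
      rcases Nat.lt_succ_iff_lt_or_eq.1 hi with hi | rfl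
      · exact hβ i hi
      · exact not_lt.1 hb
  · rintro y ⟨b, c, e, m, β, rfl, hm, hmβ, hβ⟩
    exact ⟨b, x.k, c, e, m, β, rfl, hm, fun i hi => hmβ.trans (hβ i hi)⟩

-- The entry at j is tested before it can be overwritten, so the loop acts on the live set as it was
-- before the call; this is why everything is stated through `x.dead`.
open Classical in
theorem runs_killProg (D : ℕ → ℕ → ℝ) (x : Vars) :
    Runs D killProg x (x.n * 7 + 2) fun y => ∃ o,
      y = { x with
        b := x.n
        out := o
        dead := fun u => if u < x.n ∧ x.dead u = 0 ∧ D x.a u ≤ x.m * x.W then 1 else x.dead u } ∧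
      x.out ⊆ o ∧
      (∀ u < x.n, x.dead u = 0 → D x.a u ≤ (x.m + 1 : ℕ) * x.W → (x.a, u) ∈ o) ∧
      listWeight D o = listWeight D x.out +
        ∑ u ∈ ball D x.dead x.n x.a ((x.m + 1 : ℕ) * x.W), D x.a u := by
  refine runs_forLoop_b (K := 5) (fun j y => ∃ o,
      y = { x with
        b := j
        out := o
        dead := fun u => if u < j ∧ x.dead u = 0 ∧ D x.a u ≤ x.m * x.W then 1 else x.dead u } ∧
      x.out ⊆ o ∧
      (∀ u < j, x.dead u = 0 → D x.a u ≤ (x.m + 1 : ℕ) * x.W → (x.a, u) ∈ o) ∧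
      listWeight D o = listWeight D x.out +
        ∑ u ∈ ball D x.dead j x.a ((x.m + 1 : ℕ) * x.W), D x.a u) x.n ?_ ?_ ?_
  · rintro j y ⟨o, rfl, -⟩
    exact ⟨rfl, rfl⟩
  · exact ⟨x.out, by simp, List.Subset.refl _, by simp, by simp [ball]⟩
  · rintro j y hj ⟨o, rfl, hsub, hmem, hwt⟩
    have hdead : ∀ u, (¬ (u = j ∧ x.dead u = 0 ∧ D x.a u ≤ x.m * x.W)) →
        (if u < j ∧ x.dead u = 0 ∧ D x.a u ≤ x.m * x.W then 1 else x.dead u) =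
        if u < j + 1 ∧ x.dead u = 0 ∧ D x.a u ≤ x.m * x.W then 1 else x.dead u := by
      intro u hu
      refine if_congr ⟨fun h => ⟨by omega, h.2⟩, fun h => ⟨?_, h.2⟩⟩ rfl rfl
      exact lt_of_le_of_ne (Nat.lt_succ_iff.1 h.1) fun h' => hu ⟨h', h.2⟩
    have hcond : (if j < j ∧ x.dead j = 0 ∧ D x.a j ≤ x.m * x.W then 1 else x.dead j) =
        x.dead j := if_neg fun h => lt_irrefl _ h.1
    have hmem' : ∀ o', o ⊆ o' →
        (x.dead j = 0 → D x.a j ≤ (x.m + 1 : ℕ) * x.W → (x.a, j) ∈ o') →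
        ∀ u < j + 1, x.dead u = 0 → D x.a u ≤ (x.m + 1 : ℕ) * x.W → (x.a, u) ∈ o' := by
      intro o' ho h u hu
      rcases Nat.lt_succ_iff_lt_or_eq.1 hu with hu | rfl
      · exact fun h1 h2 => ho (hmem u hu h1 h2)
      · exact h
    refine runs_ite (fun hb => (runs_skip ?_).le (by omega)) fun hb => ?_
    · have hb : 0 < if j < j ∧ x.dead j = 0 ∧ D x.a j ≤ x.m * x.W then 1 else x.dead j := hb
      rw [hcond] at hb
      refine ⟨o, ?_, hsub, hmem' o (List.Subset.refl _) fun h => absurd h hb.ne', ?_⟩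
      · congr 1
        funext u
        exact hdead u fun h => hb.ne' (h.1 ▸ h.2.1)
      · rw [hwt, ball_succ_of_neg fun h => hb.ne' h.1]
    · have hb : ¬ 0 < if j < j ∧ x.dead j = 0 ∧ D x.a j ≤ x.m * x.W then 1 else x.dead j := hb
      rw [hcond] at hb
      have h0 : x.dead j = 0 := by omega
      refine Runs.seq (K := 2) (K' := 2) ?_
      have key : ∀ o', x.out ⊆ o' →
          (∀ u < j + 1, x.dead u = 0 → D x.a u ≤ (x.m + 1 : ℕ) * x.W → (x.a, u) ∈ o') →
          listWeight D o' = listWeight D x.out +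
            ∑ u ∈ ball D x.dead (j + 1) x.a ((x.m + 1 : ℕ) * x.W), D x.a u →
          Runs D (ifNear (reg 7) (.nset 2 (reg 3) (.lit 1)))
            { x with
              b := j
              out := o'
              dead := fun u =>
                if u < j ∧ x.dead u = 0 ∧ D x.a u ≤ x.m * x.W then 1 else x.dead u } 2
            fun z => ∃ o, { z with b := z.b + 1 } = { x with
              b := j + 1
              out := o
              dead := fun u => if u < j + 1 ∧ x.dead u = 0 ∧ D x.a u ≤ x.m * x.W then 1
                else x.dead u } ∧
              x.out ⊆ o ∧
              (∀ u < j + 1, x.dead u = 0 → D x.a u ≤ (x.m + 1 : ℕ) * x.W → (x.a, u) ∈ o) ∧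
              listWeight D o = listWeight D x.out +
                ∑ u ∈ ball D x.dead (j + 1) x.a ((x.m + 1 : ℕ) * x.W), D x.a u := by
        intro o' h1 h2 h3
        refine runs_ite (fun hb => runs_skip ?_) fun hb =>
          runs_nset _ (Vars.write_dead _ _ _) ?_
        · have hb : x.m * x.W < D x.a j := hb
          refine ⟨o', ?_, h1, h2, h3⟩
          congr 1
          funext u
          exact hdead u fun h => hb.not_ge (h.1 ▸ h.2.2)
        · have hb : ¬ x.m * x.W < D x.a j := hb
          refine ⟨o', ?_, h1, h2, h3⟩
          congr 1
          funext u
          change Function.update _ j 1 u = _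
          by_cases hu : u = j
          · subst hu
            rw [Function.update_self, if_pos ⟨Nat.lt_succ_self _, h0, not_lt.1 hb⟩]
          · rw [Function.update_of_ne hu]
            exact hdead u fun h => hu h.1
      refine runs_ite (fun h1 => runs_skip ?_) fun h1 => runs_emit ?_
      · have h1 : (x.m + 1 : ℕ) * x.W < D x.a j := h1
        refine key o hsub (hmem' o (List.Subset.refl _) fun _ h => absurd h h1.not_ge) ?_
        rw [hwt, ball_succ_of_neg fun h => h1.not_ge h.2]
      · have h1 : ¬ (x.m + 1 : ℕ) * x.W < D x.a j := h1
        refine key (o ++ [(x.a, j)]) (List.Subset.trans hsub (List.subset_append_left _ _))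
          (hmem' _ (List.subset_append_left _ _) fun _ _ => by simp) ?_
        rw [listWeight_concat, hwt, ball_succ_of_pos ⟨h0, not_lt.1 h1⟩,
          Finset.sum_insert (notMem_ball_self _ _ _ _ _)]
        ring

/-- The first k ratios telescope to size k over size 0, which is at most the number of live points,
and the minimal ratio is at most each of them. -/
theorem ratio_pow_le {D : ℕ → ℕ → ℝ} (hD : ∀ i, D i i = 0) {x : Vars} (hW : 0 ≤ x.W)
    (ha : x.a < x.n) (h0 : x.dead x.a = 0) {m k : ℕ}
    (hm : ∀ i < k, x.ratio D m ≤ x.ratio D i) :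
    x.ratio D m ^ k ≤ (zeros x.n x.dead).card := by
  have hpos : ∀ i, (0 : ℝ) < x.size D i := fun i =>
    Nat.cast_pos.2 (one_le_size hD hW ha h0 i)
  have hr : 0 ≤ x.ratio D m := div_nonneg (hpos _).le (hpos _).le
  have h : ∀ j ≤ k, x.ratio D m ^ j ≤ x.size D j := by
    intro j
    induction j with
    | zero => intro _; simpa using one_le_size hD hW ha h0 0
    | succ j ih =>
      intro hj
      rw [pow_succ]
      refine (mul_le_mul (ih (by omega)) (hm j (by omega)) hr (hpos j).le).trans ?_
      rw [Vars.ratio, mul_div_cancel₀ _ (hpos j).ne']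
  exact (h k le_rfl).trans (by exact_mod_cast size_le_card_zeros D x k)

/-- The weight plus k·W·M for every point still alive never increases: the points killed in a round
pay for its star. A pair of net points is served in the round in which the first of the two dies. -/
theorem runs_ballsProg {D : ℕ → ℕ → ℝ} (x : Vars) (hD : IsMetric D x.n) (hW : 0 ≤ x.W)
    (hk : 0 < x.k) (M : ℝ)
    (hM : ∀ c c' : ℕ, 1 ≤ c → c ≤ c' → c' ≤ (zeros x.n x.dead).card →
      ((c' : ℝ) / c) ^ x.k ≤ (zeros x.n x.dead).card → (c' : ℝ) - 1 ≤ M * c) :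
    Runs D ballsProg x (x.n * (x.k * (x.n * 7 + 9) + x.n * 7 + 9) + 2) fun y =>
      ∃ a b i c e m β f o, y = { x with
        a := a, b := b, i := i, c := c, e := e, m := m, β := β, dead := f, out := o } ∧
      x.out ⊆ o ∧
      (∀ u < x.n, ∀ v < x.n, x.dead u = 0 → x.dead v = 0 → D u v ≤ x.W →
        Reach D x.n o u v ((2 * x.k - 1) * x.W)) ∧
      listWeight D o ≤ listWeight D x.out + x.k * x.W * M * (zeros x.n x.dead).card := by
  refine ((runs_forLoop_a (K := x.k * (x.n * 7 + 9) + 4 + (x.n * 7 + 2) + 1) (fun j y =>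
      ∃ b i c e m β f o, y = { x with
        a := j, b := b, i := i, c := c, e := e, m := m, β := β, dead := f, out := o } ∧
      x.out ⊆ o ∧ (∀ u, f u = 0 → x.dead u = 0) ∧ (∀ u < j, f u ≠ 0) ∧
      (∀ u < x.n, ∀ v < x.n, x.dead u = 0 → x.dead v = 0 → D u v ≤ x.W →
        f u ≠ 0 → Reach D x.n o u v ((2 * x.k - 1) * x.W)) ∧
      listWeight D o + x.k * x.W * M * (zeros x.n f).card ≤
        listWeight D x.out + x.k * x.W * M * (zeros x.n x.dead).card) x.n ?_ ?_ ?_).le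
    ?_).mono le_rfl ?_
  · rintro j y ⟨b, i, c, e, m, β, f, o, rfl, -⟩
    exact ⟨rfl, rfl⟩
  · exact ⟨x.b, x.i, x.c, x.e, x.m, x.β, x.dead, x.out, rfl, List.Subset.refl _, fun _ h => h,
      by simp, fun _ _ _ _ h _ _ h' => absurd h h', le_rfl⟩
  · rintro j y hj ⟨b₀, i₀, c₀, e₀, m₀, β₀, f, o, rfl, hsub, hf, hlt, hreach, hwt⟩
    refine runs_ite (fun hb => (runs_skip ?_).le (by omega)) fun hb => ?_
    · have hb : 0 < f j := hb
      refine ⟨b₀, i₀, c₀, e₀, m₀, β₀, f, o, rfl, hsub, hf, fun u hu => ?_, hreach, hwt⟩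
      rcases Nat.lt_succ_iff_lt_or_eq.1 hu with hu | rfl
      · exact hlt u hu
      · exact hb.ne'
    · have hb : ¬ 0 < f j := hb
      have h0 : f j = 0 := by omega
      refine Runs.seq (K := x.k * (x.n * 7 + 9) + 4) (K' := x.n * 7 + 2)
        (Runs.mono (runs_chooseProg hD.self _ ?_ ?_ ?_ ?_) le_rfl ?_)
      · exact hW
      · exact hk
      · exact hj
      · exact h0
      rintro y ⟨b, i, c, e, m, β, rfl, hm, hmin⟩
      refine (runs_killProg D _).mono le_rfl ?_
      rintro y ⟨o', rfl, hsub', hmem, hwt'⟩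
      have hpow := ratio_pow_le hD.self (x := { x with
        a := j, b := b₀, i := i₀, c := c₀, e := e₀, m := m₀, β := β₀, dead := f, out := o })
        hW hj h0 hmin
      have hc1 := one_le_size hD.self (x := { x with a := j, dead := f }) hW hj h0 m
      have hmono : (m : ℝ) * x.W ≤ (m + 1 : ℕ) * x.W := by push_cast; nlinarith
      have hcc : _ ≤ _ := Finset.card_le_card (ball_mono D f x.n j hmono)
      have hcz : _ ≤ _ := Finset.card_le_card
        (ball_subset_zeros D f x.n j ((m + 1 : ℕ) * x.W))
      have hzz : (zeros x.n f).card ≤ (zeros x.n x.dead).card :=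
        Finset.card_le_card fun u hu => by
          rw [mem_zeros] at hu ⊢
          exact ⟨hu.1, hf u hu.2⟩
      have hgrow := hM _ _ hc1 hcc (hcz.trans hzz) (hpow.trans (by exact_mod_cast hzz))
      classical
      set f' : ℕ → ℕ := fun u => if u < x.n ∧ f u = 0 ∧ D j u ≤ m * x.W then 1 else f u with hf'
      have hf'0 : ∀ u, f' u = 0 → f u = 0 := by
        intro u hu
        by_cases h : u < x.n ∧ f u = 0 ∧ D j u ≤ m * x.W
        · exact h.2.1
        · simpa [hf', h] using hu
      have hnew : ∀ u, f' u ≠ 0 → f u = 0 → D j u ≤ m * x.W := by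
        intro u hu h0
        by_contra h
        exact hu (by simp [hf', h, h0])
      refine ⟨x.n, i, c, e, m, β, f', o', rfl, List.Subset.trans hsub hsub',
        fun u hu => hf u (hf'0 u hu), fun u hu => ?_, ?_, ?_⟩
      · rcases Nat.lt_succ_iff_lt_or_eq.1 hu with hu | rfl
        · exact fun h => hlt u hu (hf'0 u h)
        · have : u < x.n ∧ f u = 0 ∧ D u u ≤ m * x.W := ⟨hj, h0, by rw [hD.self]; positivity⟩
          simp [hf', this]
      · intro u hu v hv hxu hxv huv hfu
        by_cases hfu0 : f u = 0
        · by_cases hfv0 : f v = 0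
          -- Here u dies in this round and v was alive before it, so u is within mW and v within
          -- (m+1)W of j. The path through j has length (2m+1)W, and m+1 ≤ k.
          · have hju := hnew u hfu hfu0
            have hjv : D j v ≤ (m + 1 : ℕ) * x.W := by
              have := hD.triangle j u v hj hu hv
              push_cast
              linarith
            have e1 := Reach.edge (D := D) hj hu (hmem u hu hfu0 (hju.trans hmono)) hju
            have e2 := Reach.edge (D := D) hj hv (hmem v hv hfv0 hjv) hjv
            refine (e1.symm.trans e2).mono (List.Subset.refl _) ?_
            have : (m : ℝ) + 1 ≤ x.k := by exact_mod_cast hm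
            push_cast
            nlinarith
          · exact ((hreach v hv u hu hxv hxu (by rwa [hD.symm]) hfv0).symm).mono hsub' le_rfl
        · exact (hreach u hu v hv hxu hxv huv hfu0).mono hsub' le_rfl
      -- The points killed are exactly those of the inner ball, which is what the growth bound is
      -- measured against.
      · have hsplit : ((zeros x.n f').card : ℝ) + (ball D f x.n j (m * x.W)).card =
            (zeros x.n f).card := by
          rw [← Nat.cast_add, Nat.cast_inj, ← Finset.card_union_of_disjoint]
          · congr 1
            ext u
            simp only [Finset.mem_union, mem_zeros, mem_ball]
            constructor
            · rintro (⟨h1, h2⟩ | ⟨h1, h2, -⟩)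
              · exact ⟨h1, hf'0 u h2⟩
              · exact ⟨h1, h2⟩
            · rintro ⟨h1, h2⟩
              by_cases h : f' u = 0
              · exact Or.inl ⟨h1, h⟩
              · exact Or.inr ⟨h1, h2, hnew u h h2⟩
          · rw [Finset.disjoint_left]
            intro u hu hu'
            rw [mem_zeros] at hu
            rw [mem_ball] at hu'
            have := hu.2
            simp [hf', hu'] at this
        -- The centre is at distance 0 from itself. This saves the one point in `c' - 1` and makes a
        -- single live point cost nothing.
        have hsum : ∑ u ∈ ball D f x.n j ((m + 1 : ℕ) * x.W), D j u ≤
            ((ball D f x.n j ((m + 1 : ℕ) * x.W)).card - 1) * (x.k * x.W) := by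
          have hjm : j ∈ ball D f x.n j ((m + 1 : ℕ) * x.W) :=
            mem_ball.2 ⟨hj, h0, by rw [hD.self]; positivity⟩
          rw [← Finset.sum_erase_add _ _ hjm, hD.self, add_zero,
            ← Nat.cast_pred (Finset.card_pos.2 ⟨j, hjm⟩), ← Finset.card_erase_of_mem hjm]
          refine (Finset.sum_le_card_nsmul _ _ (x.k * x.W) fun u hu => ?_).trans_eq
            (nsmul_eq_mul _ _)
          have := (mem_ball.1 (Finset.mem_of_mem_erase hu)).2.2
          refine this.trans (mul_le_mul_of_nonneg_right ?_ hW)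
          exact_mod_cast hm
        have hkW : 0 ≤ (x.k : ℝ) * x.W := by positivity
        have hwt' : listWeight D o' = listWeight D o +
          ∑ u ∈ ball D f x.n j ((m + 1 : ℕ) * x.W), D j u := hwt'
        have hgrow : ((ball D f x.n j ((m + 1 : ℕ) * x.W)).card : ℝ) - 1 ≤
          M * (ball D f x.n j (m * x.W)).card := hgrow
        have := mul_le_mul_of_nonneg_right hgrow hkW
        rw [hwt']
        rw [← hsplit] at hwt
        linarith
  · refine Nat.le_of_eq ?_
    ring
  · rintro y ⟨b, i, c, e, m, β, f, o, rfl, hsub, hf, hlt, hreach, hwt⟩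
    refine ⟨x.n, b, i, c, e, m, β, f, o, rfl, hsub, fun u hu v hv h1 h2 h3 =>
      hreach u hu v hv h1 h2 h3 (hlt u hu), ?_⟩
    have : zeros x.n f = ∅ := by
      ext u
      simp only [mem_zeros, Finset.notMem_empty, iff_false]
      exact fun h => hlt u h.1 h.2
    simpa [this] using hwt

/-! ### Thinning the net -/

theorem zeros_update (n : ℕ) (f : ℕ → ℕ) (j : ℕ) :
    zeros n (Function.update f j 1) = (zeros n f).erase j := by
  ext u
  by_cases h : u = j
  · subst h; simp [mem_zeros]
  · simp [mem_zeros, h]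

/-- A removed point pays for its one edge, of length at most δ²w, to the point j that removes it.
Only indices above j are removed from then on, so j stays in the final net and one edge suffices. -/
theorem runs_netProg {D : ℕ → ℕ → ℝ} (x : Vars) (hD : IsMetric D x.n) (hw : 0 ≤ x.w) :
    Runs D netProg x (x.n * (x.n * 5 + 5) + 2) fun y =>
      ∃ a b f o, y = { x with a := a, b := b, net := f, out := o } ∧
      x.out ⊆ o ∧
      (∀ u < x.n, x.net u = 0 → ∃ v < x.n, f v = 0 ∧ Reach D x.n o u v (x.δ * x.δ * x.w)) ∧
      (∀ u < x.n, ∀ v < x.n, u ≠ v → f u = 0 → f v = 0 → x.δ * x.δ * x.w < D u v) ∧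
      listWeight D o + x.δ * x.δ * x.w * (zeros x.n f).card ≤
        listWeight D x.out + x.δ * x.δ * x.w * (zeros x.n x.net).card := by
  have hr : 0 ≤ x.δ * x.δ * x.w := mul_nonneg (mul_self_nonneg _) hw
  refine ((runs_forLoop_a (K := x.n * (3 + 2) + 2 + 1) (fun j y =>
      ∃ b f o, y = { x with a := j, b := b, net := f, out := o } ∧
      x.out ⊆ o ∧
      (∀ u < x.n, x.net u = 0 → f u = 0 ∨
        ∃ v < j, f v = 0 ∧ Reach D x.n o u v (x.δ * x.δ * x.w)) ∧
      (∀ u < j, ∀ v < x.n, u < v → f u = 0 → f v = 0 → x.δ * x.δ * x.w < D u v) ∧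
      listWeight D o + x.δ * x.δ * x.w * (zeros x.n f).card ≤
        listWeight D x.out + x.δ * x.δ * x.w * (zeros x.n x.net).card) x.n ?_ ?_ ?_).le
    ?_).mono le_rfl ?_
  · rintro j y ⟨b, f, o, rfl, -⟩
    exact ⟨rfl, rfl⟩
  · exact ⟨x.b, x.net, x.out, rfl, List.Subset.refl _, fun _ _ h => Or.inl h, by simp, le_rfl⟩
  · rintro j y hj ⟨b, f, o, rfl, hsub, hcov, hsep, hwt⟩
    refine runs_ite (fun hb => (runs_skip ?_).le (by omega)) fun hb => ?_
    · have hb : 0 < f j := hb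
      refine ⟨b, f, o, rfl, hsub, fun u hu h => ?_, fun u hu v hv huv h1 h2 => ?_, hwt⟩
      · exact (hcov u hu h).imp_right fun ⟨v, hv, h⟩ => ⟨v, by omega, h⟩
      · rcases Nat.lt_succ_iff_lt_or_eq.1 hu with hu | rfl
        · exact hsep u hu v hv huv h1 h2
        · exact absurd h1 hb.ne'
    · have hb : ¬ 0 < f j := hb
      have h0 : f j = 0 := by omega
      refine (runs_forLoop_b (K := 3) (fun l y =>
        ∃ g p, y = { x with a := j, b := l, net := g, out := p } ∧ o ⊆ p ∧
        (∀ u, (u ≤ j ∨ l ≤ u) → g u = f u) ∧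
        (∀ u, g u = 0 → f u = 0) ∧
        (∀ u < x.n, f u = 0 → g u ≠ 0 → Reach D x.n p u j (x.δ * x.δ * x.w)) ∧
        (∀ u < l, j < u → g u = 0 → x.δ * x.δ * x.w < D j u) ∧
        listWeight D p + x.δ * x.δ * x.w * (zeros x.n g).card ≤
          listWeight D x.out + x.δ * x.δ * x.w * (zeros x.n x.net).card) x.n ?_ ?_ ?_).mono
        le_rfl ?_
      · rintro l y ⟨g, p, rfl, -⟩
        exact ⟨rfl, rfl⟩
      · exact ⟨f, o, rfl, List.Subset.refl _, fun _ _ => rfl, fun _ h => h,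
          fun _ _ h h' => absurd h h', by simp, hwt⟩
      · rintro l y hl ⟨g, p, rfl, hsub', hgf, hg0, hreach, hsep', hwt'⟩
        refine runs_ite (fun hb => ?_) fun hb => (runs_skip ?_).le (by omega)
        · obtain ⟨hjl, hgl, hd⟩ : j < l ∧ ¬ 0 < g l ∧ ¬ x.δ * x.δ * x.w < D j l := hb
          have hgl : g l = 0 := by omega
          refine Runs.seq (K := 1) (K' := 1) (runs_emit (runs_nset _ (Vars.write_net _ _ _) ?_))
            |>.le (by omega)
          refine ⟨Function.update g l 1, p ++ [(j, l)], rfl,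
            List.Subset.trans hsub' (List.subset_append_left _ _), fun u hu => ?_,
            fun u hu => ?_, fun u hu hfu hgu => ?_, fun u hu hju hgu => ?_, ?_⟩
          · rw [Function.update_of_ne (by omega)]
            exact hgf u (by omega)
          · by_cases h : u = l
            · subst h; simp at hu
            · rw [Function.update_of_ne h] at hu
              exact hg0 u hu
          · by_cases h : u = l
            · subst h
              exact (Reach.edge hj hu (by simp) (not_lt.1 hd)).symm
            · rw [Function.update_of_ne h] at hgu
              exact (hreach u hu hfu hgu).mono (List.subset_append_left _ _) le_rfl
          · by_cases h : u = l
            · subst h; simp at hgu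
            · rw [Function.update_of_ne h] at hgu
              exact hsep' u (by omega) hju hgu
          · rw [listWeight_concat, zeros_update]
            have hml : l ∈ zeros x.n g := mem_zeros.2 ⟨hl, hgl⟩
            rw [Finset.card_erase_of_mem hml, Nat.cast_pred (Finset.card_pos.2 ⟨l, hml⟩)]
            linarith [not_lt.1 hd]
        · have hb : ¬ (j < l ∧ ¬ 0 < g l ∧ ¬ x.δ * x.δ * x.w < D j l) := hb
          refine ⟨g, p, rfl, hsub', fun u hu => hgf u (by omega), hg0, hreach,
            fun u hu hju hgu => ?_, hwt'⟩
          rcases Nat.lt_succ_iff_lt_or_eq.1 hu with hu | rfl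
          · exact hsep' u hu hju hgu
          · by_contra h
            exact hb ⟨hju, by omega, h⟩
      · rintro y ⟨g, p, rfl, hsub', hgf, hg0, hreach, hsep', hwt'⟩
        refine ⟨x.n, g, p, rfl, List.Subset.trans hsub hsub', fun u hu h => ?_,
          fun u hu v hv huv h1 h2 => ?_, hwt'⟩
        · rcases hcov u hu h with h | ⟨v, hv, hfv, h⟩
          · by_cases hgu : g u = 0
            · exact Or.inl hgu
            · exact Or.inr ⟨j, by omega, by rw [hgf j (by omega), h0], hreach u hu h hgu⟩
          · exact Or.inr ⟨v, by omega, by rw [hgf v (by omega), hfv], h.mono hsub' le_rfl⟩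
        · rcases Nat.lt_succ_iff_lt_or_eq.1 hu with hu | rfl
          · exact hsep u hu v hv huv (hg0 u h1) (hg0 v h2)
          · exact hsep' v hv huv h2
  · refine Nat.le_of_eq ?_
    ring
  · rintro y ⟨b, f, o, rfl, hsub, hcov, hsep, hwt⟩
    refine ⟨x.n, b, f, o, rfl, hsub, fun u hu h => ?_, fun u hu v hv huv h1 h2 => ?_, hwt⟩
    · rcases hcov u hu h with h | h
      · exact ⟨u, hu, h, .refl hu hr⟩
      · exact h
    · rcases lt_or_gt_of_ne huv with h | h
      · exact hsep u hu v hv h h1 h2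
      · rw [hD.symm]
        exact hsep v hv u hu h h2 h1

/-! ### One scale -/

/-- Bound for the average number of edges per killed point in ball growing on `q` points. -/
noncomputable def growth (k q : ℕ) : ℝ := if q ≤ 1 then 0 else (q : ℝ) ^ (1 / (k : ℝ))

/-- For q ≤ 1 the ball is a single point and c' - 1 = 0. Growth 0 is needed there, since packing
does not bound the scale at which one net point remains. -/
theorem sub_one_le_growth_mul {k q : ℕ} (hk : 0 < k) {c c' : ℕ} (hc : 1 ≤ c) (hcc : c ≤ c')
    (hq : c' ≤ q) (h : ((c' : ℝ) / c) ^ k ≤ q) : (c' : ℝ) - 1 ≤ growth k q * c := by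
  unfold growth
  split_ifs with hq1
  · obtain rfl : c' = 1 := by omega
    simp
  · have hc0 : (0 : ℝ) < c := by exact_mod_cast hc
    have h1 : (c' : ℝ) / c ≤ (q : ℝ) ^ (1 / (k : ℝ)) := by
      rw [one_div, ← Real.pow_rpow_inv_natCast (x := (c' : ℝ) / c) (by positivity) hk.ne']
      exact Real.rpow_le_rpow (by positivity) h (by positivity)
    rw [div_le_iff₀ hc0] at h1
    linarith

/-- Bound for the number of steps of `scaleProg`. -/
def scaleSteps (n k : ℕ) : ℕ :=
  1 + ((n * 3 + 2) + ((n * (k * (n * 7 + 9) + n * 7 + 9) + 2) + ((n * (n * 5 + 5) + 2) + 1)))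

/-- The factor 2k+1 consists of 2k for ball growing, where 1+3δ ≤ 2, and 1 for thinning. -/
theorem runs_scaleProg {D : ℕ → ℕ → ℝ} (x : Vars) (hD : IsMetric D x.n) (hn : 0 < x.n)
    (hk : 0 < x.k) (hw : 0 ≤ x.w) (hδ : 0 ≤ x.δ) (hδ1 : x.δ ≤ 1 / 5)
    (hcov : ∀ u < x.n, ∃ v < x.n, x.net v = 0 ∧ Reach D x.n x.out u v (x.δ * x.w)) :
    Runs D scaleProg x (scaleSteps x.n x.k) fun y =>
      y.n = x.n ∧ y.k = x.k ∧ y.δ = x.δ ∧ y.S = x.S ∧ y.w = x.w * (1 + x.δ) ∧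
      x.out ⊆ y.out ∧
      (∀ u < x.n, ∀ v < x.n, D u v ≤ x.w * (1 + x.δ) →
        Reach D x.n y.out u v ((2 * x.k - 1) * (1 + 5 * x.δ) * x.w)) ∧
      (∀ u < x.n, ∃ v < x.n, y.net v = 0 ∧
        Reach D x.n y.out u v (x.δ * (x.w * (1 + x.δ)))) ∧
      (∀ u < x.n, ∀ v < x.n, u ≠ v → y.net u = 0 → y.net v = 0 →
        x.δ * x.δ * x.w < D u v) ∧
      listWeight D y.out ≤ listWeight D x.out + (2 * x.k + 1) *
        (x.w * growth x.k (zeros x.n x.net).card * (zeros x.n x.net).card) := by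
  have hk1 : (1 : ℝ) ≤ x.k := by exact_mod_cast hk
  refine Runs.seq (runs_rset _ (Vars.write_W _ _) ?_)
  refine Runs.seq ((runs_resetProg D _).mono le_rfl ?_)
  rintro y ⟨f, rfl, hf⟩
  have hfz : zeros x.n f = zeros x.n x.net := by
    ext u
    simp only [mem_zeros]
    refine and_congr_right fun hu => ?_
    rw [hf u hu]
  have hWe : RExp.eval D x.toState
      (.mul (.add (.ofNat (.lit 1)) (.mul (.ofNat (.lit 3)) (rreg 3))) (rreg 2)) =
      (1 + 3 * x.δ) * x.w := by
    change (((1 : ℕ) : ℝ) + ((3 : ℕ) : ℝ) * x.δ) * x.w = _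
    norm_num
  simp only [hWe]
  have hW : 0 ≤ (1 + 3 * x.δ) * x.w := by positivity
  refine Runs.seq (Runs.mono (runs_ballsProg _ ?_ ?_ ?_ (growth x.k (zeros x.n x.net).card) ?_)
    le_rfl ?_)
  · exact hD
  · exact hW
  · exact hk
  · intro c c' h1 h2 h3 h4
    change c' ≤ (zeros x.n f).card at h3
    change _ ≤ ((zeros x.n f).card : ℝ) at h4
    rw [hfz] at h3 h4
    exact sub_one_le_growth_mul hk h1 h2 h3 h4
  rintro y ⟨a, b, i, c, e, m, β, g, o, rfl, hsub, hreach, hwt⟩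
  refine Runs.seq (Runs.mono (runs_netProg _ ?_ ?_) le_rfl ?_)
  · exact hD
  · exact hw
  rintro y ⟨a', b', N, o', rfl, hsub', hcov', hsep, hwt'⟩
  refine runs_rset _ (Vars.write_w _ _) ?_
  have hwe : ∀ z : Vars, RExp.eval D z.toState
      (.mul (rreg 2) (.add (.ofNat (.lit 1)) (rreg 3))) = z.w * (1 + z.δ) := by
    intro z
    change z.w * (((1 : ℕ) : ℝ) + z.δ) = _
    norm_num
  have hcovo : ∀ u < x.n, ∃ v < x.n, x.net v = 0 ∧ Reach D x.n o' u v (x.δ * x.w) :=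
    fun u hu => by
      obtain ⟨v, hv, h0, h⟩ := hcov u hu
      exact ⟨v, hv, h0, h.mono (List.Subset.trans hsub hsub') le_rfl⟩
  refine ⟨rfl, rfl, rfl, rfl, hwe _, List.Subset.trans hsub hsub', fun u hu v hv huv => ?_,
    fun u hu => ?_, hsep, ?_⟩
  · obtain ⟨p, hp, hp0, hup⟩ := hcovo u hu
    obtain ⟨q, hq, hq0, hvq⟩ := hcovo v hv
    -- The distance is at most (1+δ)w plus a detour of δw at each end; this is where the factor 1+3δ
    -- in W comes from.
    have hpq : D p q ≤ (1 + 3 * x.δ) * x.w := by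
      have h1 := hup.symm.dist_le hD
      have h2 := hvq.dist_le hD
      have h3 := hD.triangle p u q hp hu hq
      have h4 := hD.triangle u v q hu hv hq
      linarith
    have hmid := hreach p hp q hq ((hf p hp).trans hp0) ((hf q hq).trans hq0) hpq
    refine ((hup.trans (hmid.mono hsub' le_rfl)).trans hvq.symm).mono (List.Subset.refl _) ?_
    change x.δ * x.w + (2 * x.k - 1) * ((1 + 3 * x.δ) * x.w) + x.δ * x.w ≤ _
    -- The two detours add 2δw, which is at most (2k-1)·2δw; together with 3δ this makes 5δ.
    nlinarith [mul_nonneg hδ hw]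
  · obtain ⟨p, hp, hp0, hup⟩ := hcovo u hu
    obtain ⟨q, hq, hq0, hpq⟩ := hcov' p hp hp0
    refine ⟨q, hq, hq0, (hup.trans hpq).mono (List.Subset.refl _) ?_⟩
    change x.δ * x.w + x.δ * x.δ * x.w ≤ _
    linarith
  · change listWeight D o' ≤ _
    change listWeight D o' + x.δ * x.δ * x.w * (zeros x.n N).card ≤
      listWeight D o + x.δ * x.δ * x.w * (zeros x.n x.net).card at hwt'
    change listWeight D o ≤ listWeight D x.out + x.k * ((1 + 3 * x.δ) * x.w) *
      growth x.k (zeros x.n x.net).card * (zeros x.n f).card at hwt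
    rw [hfz] at hwt
    -- A nonempty net never becomes empty, so for q = 1 thinning costs nothing either.
    have hN : (1 : ℝ) ≤ (zeros x.n N).card := by
      obtain ⟨p, hp, hp0, -⟩ := hcov 0 hn
      obtain ⟨q, hq, hq0, -⟩ := hcov' p hp hp0
      exact_mod_cast Finset.card_pos.2 ⟨q, mem_zeros.2 ⟨hq, hq0⟩⟩
    set q := (zeros x.n x.net).card with hq
    have hδδ : x.δ * x.δ ≤ 1 := by nlinarith
    have hr0 : 0 ≤ x.δ * x.δ * x.w := by positivity
    by_cases hq1 : q ≤ 1
    · have hg : growth x.k q = 0 := if_pos hq1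
      have hq1' : (q : ℝ) ≤ 1 := by exact_mod_cast hq1
      rw [hg] at hwt ⊢
      nlinarith
    · have hg : 1 ≤ growth x.k q := by
        rw [growth, if_neg hq1]
        refine Real.one_le_rpow ?_ (by positivity)
        exact_mod_cast (by omega : 1 ≤ q)
      have h1 : x.w * q ≤ x.w * growth x.k q * q := by
        have : 0 ≤ x.w * q := by positivity
        nlinarith
      have h2 : x.δ * x.δ * x.w * q ≤ x.w * q := by
        have : 0 ≤ x.w * q := by positivity
        nlinarith
      have h3 : x.k * ((1 + 3 * x.δ) * x.w) * growth x.k q * q ≤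
          2 * x.k * (x.w * growth x.k q * q) := by
        have h4 : 0 ≤ x.w * growth x.k q * q := by positivity
        have h5 : x.k * (1 + 3 * x.δ) ≤ 2 * x.k := by nlinarith
        nlinarith [mul_le_mul_of_nonneg_right h5 h4]
      have h6 : 0 ≤ x.δ * x.δ * x.w * (zeros x.n N).card := by positivity
      linarith

/-! ### Summation over the scales -/

/-- A potential that increases by at least `min x (x ^ (-θ))` from `x` to `(1 + δ) * x`. -/
noncomputable def potential (θ δ x : ℝ) : ℝ :=
  if x ≤ 1 then x / δ else (1 + δ) / δ + (1 - x ^ (-θ)) / (1 - (1 + δ) ^ (-θ))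

section Potential

variable {θ δ x : ℝ}

theorem rpow_neg_lt_one (hθ : 0 < θ) (hδ : 0 < δ) : (1 + δ) ^ (-θ) < 1 :=
  Real.rpow_lt_one_of_one_lt_of_neg (by linarith) (by linarith)

theorem potential_nonneg (hθ : 0 < θ) (hδ : 0 < δ) (hx : 0 ≤ x) : 0 ≤ potential θ δ x := by
  unfold potential
  split_ifs with h
  · positivity
  · have h1 := rpow_neg_lt_one hθ hδ
    have h2 : x ^ (-θ) ≤ 1 :=
      Real.rpow_le_one_of_one_le_of_nonpos (not_le.1 h).le (by linarith)
    have := div_nonneg (sub_nonneg.2 h2) (sub_pos.2 h1).le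
    positivity

theorem potential_le (hθ : 0 < θ) (hδ : 0 < δ) (hx : 0 ≤ x) :
    potential θ δ x ≤ (1 + δ) / δ + 1 / (1 - (1 + δ) ^ (-θ)) := by
  have h1 := sub_pos.2 (rpow_neg_lt_one hθ hδ)
  unfold potential
  split_ifs with h
  · have : x / δ ≤ (1 + δ) / δ := div_le_div_of_nonneg_right (by linarith) hδ.le
    have : 0 < 1 / (1 - (1 + δ) ^ (-θ)) := by positivity
    linarith
  · have : 0 ≤ x ^ (-θ) := Real.rpow_nonneg hx _
    gcongr
    linarith

/-- Both branches are partial sums of geometric series with ratio 1+δ, respectively (1+δ)^(-θ). The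
offset (1+δ)/δ of the second branch covers the one step that crosses 1, as x/δ + x = x(1+δ)/δ. -/
theorem potential_add_min_le (hθ : 0 < θ) (hδ : 0 < δ) (hx : 0 < x) :
    potential θ δ x + min x (x ^ (-θ)) ≤ potential θ δ (x * (1 + δ)) := by
  have h1 := sub_pos.2 (rpow_neg_lt_one hθ hδ)
  have e1 : x / δ + x = x * (1 + δ) / δ := by field_simp
  by_cases hx1 : x ≤ 1
  · by_cases hx2 : x * (1 + δ) ≤ 1
    · rw [potential, if_pos hx1, potential, if_pos hx2, ← e1]
      linarith [min_le_left x (x ^ (-θ))]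
    · rw [potential, if_pos hx1, potential, if_neg hx2]
      have h2 : (x * (1 + δ)) ^ (-θ) ≤ 1 :=
        Real.rpow_le_one_of_one_le_of_nonpos (not_le.1 hx2).le (by linarith)
      have h3 := div_nonneg (sub_nonneg.2 h2) h1.le
      have h4 : x * (1 + δ) / δ ≤ (1 + δ) / δ :=
        div_le_div_of_nonneg_right (by nlinarith) hδ.le
      linarith [min_le_left x (x ^ (-θ))]
  · have hx2 : ¬ x * (1 + δ) ≤ 1 := by
      push Not at hx1 ⊢
      nlinarith
    rw [potential, if_neg hx1, potential, if_neg hx2,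
      Real.mul_rpow hx.le (by linarith : (0 : ℝ) ≤ 1 + δ)]
    have e2 : (1 - x ^ (-θ)) / (1 - (1 + δ) ^ (-θ)) + x ^ (-θ) =
        (1 - x ^ (-θ) * (1 + δ) ^ (-θ)) / (1 - (1 + δ) ^ (-θ)) := by
      field_simp
      ring
    linarith [min_le_right x (x ^ (-θ))]

end Potential

/-- The ratio nw/Y measures w against the critical scale Y/n. The first term of the minimum uses q ≤
n, the second q ≤ Y/w. -/
theorem mul_growth_mul_le {k q n : ℕ} {w Y : ℝ} (hw : 0 < w) (hY : 0 < Y)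
    (hn : 0 < n) (hqn : q ≤ n) (hq : 2 ≤ q → q * w ≤ Y) :
    w * growth k q * q ≤ Y * (n : ℝ) ^ (1 / (k : ℝ)) *
      min (n * w / Y) ((n * w / Y) ^ (-(1 / (k : ℝ)))) := by
  have hn0 : (0 : ℝ) < n := by exact_mod_cast hn
  set θ := 1 / (k : ℝ) with hθ
  have hθ0 : 0 ≤ θ := by positivity
  unfold growth
  split_ifs with hq1
  · rw [mul_zero, zero_mul]
    positivity
  · have hq2 := hq (by omega)
    have hq0 : (0 : ℝ) < q := by exact_mod_cast (by omega : 0 < q)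
    have hqn' : (q : ℝ) ≤ n := by exact_mod_cast hqn
    rw [mul_min_of_nonneg _ _ (by positivity), le_min_iff]
    constructor
    · have h1 : (q : ℝ) ^ θ ≤ (n : ℝ) ^ θ := Real.rpow_le_rpow hq0.le hqn' hθ0
      have e : Y * (n : ℝ) ^ θ * (n * w / Y) = w * (n : ℝ) ^ θ * n := by field_simp
      rw [e]
      gcongr
    · have h1 : (q : ℝ) ^ θ ≤ (Y / w) ^ θ :=
        Real.rpow_le_rpow hq0.le ((le_div_iff₀ hw).2 hq2) hθ0
      have e : Y * (n : ℝ) ^ θ * (n * w / Y) ^ (-θ) = Y * (Y / w) ^ θ := by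
        rw [Real.rpow_neg (by positivity), ← Real.inv_rpow (by positivity), mul_assoc,
          ← Real.mul_rpow hn0.le (by positivity)]
        congr 2
        field_simp
      rw [e]
      calc w * (q : ℝ) ^ θ * q = (q * w) * (q : ℝ) ^ θ := by ring
        _ ≤ Y * (Y / w) ^ θ := by gcongr

/-! ### The whole program -/

theorem dist_le_sum {D : ℕ → ℕ → ℝ} {n : ℕ} (hD : IsMetric D n) {u v : ℕ} (hu : u < n)
    (hv : v < n) : D u v ≤ ∑ i ∈ Finset.range n, D 0 i := by
  by_cases h : u = v
  · subst h
    rw [hD.self]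
    exact Finset.sum_nonneg fun i _ => hD.nonneg 0 i
  · refine (hD.triangle u 0 v hu (by omega) hv).trans ?_
    rw [hD.symm u 0, ← Finset.sum_pair (f := D 0) h]
    refine Finset.sum_le_sum_of_subset_of_nonneg (fun i hi => ?_) fun i _ _ => hD.nonneg 0 i
    rw [Finset.mem_insert, Finset.mem_singleton] at hi
    rw [Finset.mem_range]
    omega

/-- Packing for the pair of points 0 and i gives 2·D 0 i ≤ 2X. -/
theorem Pack.sum_le {D : ℕ → ℕ → ℝ} {n : ℕ} {X : ℝ} (hX : Pack D n X) (hD : IsMetric D n) :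
    ∑ i ∈ Finset.range n, D 0 i ≤ n * X := by
  have : ∀ i ∈ Finset.range n, D 0 i ≤ X := by
    intro i hi
    rw [Finset.mem_range] at hi
    by_cases h0 : 0 = i
    · rw [← h0, hD.self]
      exact hX.nonneg
    · have hcard : ({0, i} : Finset ℕ).card = 2 := Finset.card_pair h0
      have := hX.bound {0, i} (D 0 i) (hD.nonneg 0 i) hcard.ge
        (fun a ha => by
          rw [Finset.mem_insert, Finset.mem_singleton] at ha
          omega)
        (fun a ha b hb hab => by
          rw [Finset.mem_insert, Finset.mem_singleton] at ha hb
          rcases ha with rfl | rfl <;> rcases hb with rfl | rfl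
          · exact absurd rfl hab
          · exact le_rfl
          · exact (hD.symm _ _).le
          · exact absurd rfl hab)
      rw [hcard] at this
      push_cast at this
      linarith
  simpa using Finset.sum_le_card_nsmul _ _ _ this

/-- The invariant of the loop over the scales, where `S` is the sum of the first row. -/
structure ScaleInv (D : ℕ → ℕ → ℝ) (n k : ℕ) (ε δ S : ℝ) (j : ℕ) (y : Vars) : Prop where
  n_eq : y.n = n
  k_eq : y.k = k
  δ_eq : y.δ = δ
  S_eq : y.S = S
  w_eq : y.w = S / (n * n * n) * (1 + δ) ^ j
  cover : ∀ u < n, ∃ v < n, y.net v = 0 ∧ Reach D n y.out u v (δ * y.w)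
  stretch : ∀ u < n, ∀ v < n, D u v ≤ y.w →
    Reach D n y.out u v ((2 * k - 1) * (1 + ε) * D u v)
  pack : ∀ X, Pack D n X → 2 ≤ (zeros n y.net).card →
    (zeros n y.net).card * y.w ≤ 4 / (δ * δ) * X
  weight : ∀ X, Pack D n X → listWeight D y.out ≤ X + (2 * k + 1) *
    (4 / (δ * δ) * X * (n : ℝ) ^ (1 / (k : ℝ)) *
      potential (1 / (k : ℝ)) δ (n * y.w / (4 / (δ * δ) * X)))

section Scales

variable {D : ℕ → ℕ → ℝ} {n k : ℕ} {ε δ : ℝ}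

theorem ScaleInv.step (hD : IsMetric D n) (hn : 0 < n) (hk : 0 < k) (hδ : 0 < δ)
    (hδ1 : δ ≤ 1 / 5) (hδε : 5 * δ ≤ ε) {j : ℕ} {y : Vars} {S : ℝ} (hS : 0 < S)
    (hSX : ∀ X, Pack D n X → S ≤ n * X) (h : ScaleInv D n k ε δ S j y) :
    Runs D scaleProg y (scaleSteps n k) (ScaleInv D n k ε δ S (j + 1)) := by
  obtain ⟨rfl, rfl, rfl, rfl, hw, hcov, hstr, hpack, hwt⟩ := h
  have hn0 : (0 : ℝ) < y.n := by exact_mod_cast hn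
  have hk1 : (1 : ℝ) ≤ y.k := by exact_mod_cast hk
  have hw0 : 0 < y.w := by rw [hw]; positivity
  refine (runs_scaleProg y hD hn hk hw0.le hδ.le hδ1 hcov).mono le_rfl ?_
  rintro z ⟨h1, h2, h3, h4, h5, hsub, hreach, hcov', hsep, hwt'⟩
  refine ⟨h1, h2, h3, h4, by rw [h5, hw, pow_succ, mul_assoc], fun u hu => ?_,
    fun u hu v hv huv => ?_, fun X hX hq => ?_, fun X hX => ?_⟩
  · rw [h5]
    exact hcov' u hu
  · rw [h5] at huv
    by_cases hle : D u v ≤ y.w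
    · exact (hstr u hu v hv hle).mono hsub le_rfl
    · refine (hreach u hu v hv huv).mono (List.Subset.refl _) ?_
      have hk2 : (0 : ℝ) ≤ 2 * y.k - 1 := by linarith
      have := (not_le.1 hle).le
      gcongr
      exact mul_nonneg hk2 (by linarith)
  -- Separation δ²w at the old scale gives qδ²w ≤ 2X; passing to the new scale costs 1+δ ≤ 2, whence
  -- the 4 in Y.
  · have hb := hX.bound _ (y.δ * y.δ * y.w) (by positivity) hq
      (fun a ha => (mem_zeros.1 ha).1) fun a ha b hb hab =>
        (hsep a (mem_zeros.1 ha).1 b (mem_zeros.1 hb).1 hab (mem_zeros.1 ha).2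
          (mem_zeros.1 hb).2).le
    rw [h5, div_mul_eq_mul_div, le_div_iff₀ (by positivity)]
    have : (zeros y.n z.net).card * (y.w * (1 + y.δ)) * (y.δ * y.δ) =
      (zeros y.n z.net).card * (y.δ * y.δ * y.w) * (1 + y.δ) := by ring
    rw [this]
    nlinarith [hX.nonneg]
  -- The loop body runs only for S > 0, and S ≤ nX then excludes X = 0; so division by Y is
  -- meaningful.
  · have hX0 : 0 < X := by
      by_contra hX0
      have := hSX X hX
      nlinarith
    have hY : 0 < 4 / (y.δ * y.δ) * X := by positivity
    set Y := 4 / (y.δ * y.δ) * X with hYdef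
    have hg := mul_growth_mul_le (k := y.k) hw0 hY hn (card_zeros_le y.n y.net) (hpack X hX)
    have hpot := potential_add_min_le (θ := 1 / (y.k : ℝ)) (by positivity) hδ
      (x := y.n * y.w / Y) (by positivity)
    have e : y.n * y.w / Y * (1 + y.δ) = y.n * z.w / Y := by
      rw [h5]
      ring
    rw [e] at hpot
    have hc : 0 ≤ Y * (y.n : ℝ) ^ (1 / (y.k : ℝ)) := by positivity
    have h6 := mul_le_mul_of_nonneg_left hpot hc
    rw [mul_add] at h6
    have h7 : (0 : ℝ) ≤ 2 * y.k + 1 := by positivity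
    have h8 := mul_le_mul_of_nonneg_left ((add_le_add_right hg _).trans h6) h7
    have h9 := hwt X hX
    rw [mul_add] at h8
    linarith

/-- Bound for the number of scales. -/
noncomputable def scaleCount (n : ℕ) (δ : ℝ) : ℕ := ⌈3 * Real.log n / Real.log (1 + δ)⌉₊

theorem ScaleInv.lt_scaleCount (hn : 0 < n) (hδ : 0 < δ) {j : ℕ} {y : Vars} {S : ℝ}
    (hS : 0 < S) (h : ScaleInv D n k ε δ S j y) (hlt : y.w < S) : j < scaleCount n δ := by
  have hn0 : (0 : ℝ) < n := by exact_mod_cast hn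
  rw [scaleCount, Nat.lt_ceil, lt_div_iff₀ (Real.log_pos (by linarith))]
  rw [h.w_eq, div_mul_eq_mul_div, div_lt_iff₀ (by positivity)] at hlt
  have h1 : (1 + δ) ^ j < (n : ℝ) ^ 3 := by
    have := lt_of_mul_lt_mul_left hlt hS.le
    linarith [pow_succ (n : ℝ) 2, pow_two (n : ℝ)]
  have h2 := Real.log_lt_log (by positivity) h1
  rw [Real.log_pow, Real.log_pow] at h2
  exact_mod_cast h2

theorem runs_spannerProg (hD : IsMetric D n) (hn : 0 < n) (hk : 0 < k) (hε : 0 < ε)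
    (hδe : δ = ε / (5 + 5 * ε)) :
    Runs D spannerProg (Vars.start n k ε)
      ((n * 3 + 2) + (1 + (1 + ((n * (n * 4 + 4) + 2) +
        (scaleCount n δ * (scaleSteps n k + 1) + 1)))))
      fun y => (∀ u < n, ∀ v < n, Reach D n y.out u v ((2 * k - 1) * (1 + ε) * D u v)) ∧
        ∀ X, Pack D n X → listWeight D y.out ≤ X + (2 * k + 1) *
          (4 / (δ * δ) * X * (n : ℝ) ^ (1 / (k : ℝ)) *
            ((1 + δ) / δ + 1 / (1 - (1 + δ) ^ (-(1 / (k : ℝ)))))) := by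
  have hn0 : (0 : ℝ) < n := by exact_mod_cast hn
  have hn1 : (1 : ℝ) ≤ n := by exact_mod_cast hn
  have hk1 : (1 : ℝ) ≤ k := by exact_mod_cast hk
  have hδ : 0 < δ := by rw [hδe]; positivity
  have hδ1 : δ ≤ 1 / 5 := by
    rw [hδe, div_le_div_iff₀ (by positivity) (by norm_num)]
    linarith
  have hδε : 5 * δ ≤ ε := by
    rw [hδe, ← mul_div_assoc, div_le_iff₀ (by positivity)]
    nlinarith
  have ht : (1 : ℝ) ≤ (2 * k - 1) * (1 + ε) := by nlinarith
  have hB : (4 : ℝ) ≤ 4 / (δ * δ) := by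
    rw [le_div_iff₀ (by positivity)]
    nlinarith
  set S : ℝ := ∑ i ∈ Finset.range n, D 0 i with hS
  have hS0 : 0 ≤ S := Finset.sum_nonneg fun i _ => hD.nonneg 0 i
  refine Runs.seq ((runs_sumProg D _).mono le_rfl ?_)
  rintro y rfl
  refine Runs.seq (runs_rset _ (Vars.write_w _ _) ?_)
  refine Runs.seq (runs_rset _ (Vars.write_δ _ _) ?_)
  refine Runs.seq (Runs.mono (runs_lightProg D _ ?_ rfl) le_rfl ?_)
  · change 0 ≤ (0 + S) / ((n : ℝ) * n * n)
    positivity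
  rintro y ⟨a, b, o, rfl, hlight, hwt⟩
  change ∀ p < n, ∀ q < n, D p q ≤ (0 + S) / ((n : ℝ) * n * n) → (p, q) ∈ o at hlight
  change listWeight D o ≤ n * n * ((0 + S) / ((n : ℝ) * n * n)) at hwt
  rw [zero_add] at hlight hwt
  have hwS : (n : ℝ) * n * (S / (n * n * n)) = S / n := by field_simp
  rw [hwS] at hwt
  refine (runs_loop (ScaleInv D n k ε δ S) (scaleCount n δ) ?_ ?_).mono le_rfl ?_
  · have hδ' : ∀ z : Vars, z.ε = ε → RExp.eval D z.toState (.div (rreg 0)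
        (.add (.ofNat (.lit 5)) (.mul (.ofNat (.lit 5)) (rreg 0)))) = δ := by
      intro z hz
      change z.ε / (((5 : ℕ) : ℝ) + ((5 : ℕ) : ℝ) * z.ε) = δ
      rw [hz, hδe]
      norm_num
    have hw : (0 + S) / ((n : ℝ) * n * n) = S / (n * n * n) := by rw [zero_add]
    have hw0 : 0 ≤ S / ((n : ℝ) * n * n) := by positivity
    refine ⟨rfl, rfl, hδ' _ rfl, zero_add S, ?_, fun u hu => ⟨u, hu, rfl, .refl hu ?_⟩,
      fun u hu v hv huv => ?_, fun X hX _ => ?_, fun X hX => ?_⟩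
    · rw [pow_zero, mul_one]
      exact hw
    · change 0 ≤ δ * ((0 + S) / ((n : ℝ) * n * n))
      rw [hw]
      positivity
    · change D u v ≤ (0 + S) / ((n : ℝ) * n * n) at huv
      rw [hw] at huv
      exact .edge hu hv (hlight u hu v hv huv) (le_mul_of_one_le_left (hD.nonneg u v) ht)
    -- Initially every point is in the net, and n·S/n³ ≤ X already follows from S ≤ nX.
    · change ((zeros n fun _ => 0).card : ℝ) * ((0 + S) / ((n : ℝ) * n * n)) ≤ _
      rw [hw]
      have h1 : ((zeros n fun _ => 0).card : ℝ) ≤ n := by exact_mod_cast card_zeros_le n _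
      have h2 := hX.sum_le hD
      have h3 : n * (S / ((n : ℝ) * n * n)) ≤ X := by
        rw [← mul_div_assoc, div_le_iff₀ (by positivity)]
        have : (n : ℝ) * X ≤ n * X * n := le_mul_of_one_le_right
          (mul_nonneg hn0.le hX.nonneg) hn1
        nlinarith
      nlinarith [mul_le_mul_of_nonneg_right h1 hw0, hX.nonneg]
    · refine hwt.trans ?_
      have h2 := hX.sum_le hD
      have h3 : S / n ≤ X := by
        rw [div_le_iff₀ hn0]
        linarith
      have hX0 := hX.nonneg
      have h4 := potential_nonneg (θ := 1 / (k : ℝ)) (δ := δ)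
        (x := n * ((0 + S) / ((n : ℝ) * n * n)) / (4 / (δ * δ) * X)) (by positivity) hδ
        (by rw [hw]; positivity)
      refine h3.trans (le_add_of_nonneg_right ?_)
      exact mul_nonneg (by positivity) (mul_nonneg (by positivity) h4)
  · intro j y hy hb
    have hb : y.w < y.S := hb
    rw [hy.S_eq] at hb
    have hSpos : 0 < S := by
      refine lt_of_le_of_lt ?_ hb
      rw [hy.w_eq]
      positivity
    exact ⟨hy.lt_scaleCount hn hδ hSpos hb,
      hy.step hD hn hk hδ hδ1 hδε hSpos fun X hX => hX.sum_le hD⟩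
  · rintro y ⟨hb, j, hy⟩
    have hb : ¬ y.w < y.S := hb
    rw [hy.S_eq, not_lt] at hb
    -- At exit w ≥ S, and S bounds every distance, so all pairs have been treated. If S = 0, the
    -- loop is skipped and the light edges already suffice.
    refine ⟨fun u hu v hv => hy.stretch u hu v hv ((dist_le_sum hD hu hv).trans hb),
      fun X hX => (hy.weight X hX).trans ?_⟩
    have hX0 := hX.nonneg
    have hw0 : 0 ≤ y.w := hS0.trans hb
    gcongr
    exact potential_le (by positivity) hδ (by positivity)

end Scales

/-! ### Counting steps and fixing the constant -/

theorem steps_le {n k : ℕ} {δ : ℝ} (hn : 0 < n) (hk : 0 < k) (hδ : 0 < δ) :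
    (((n * 3 + 2) + (1 + (1 + ((n * (n * 4 + 4) + 2) +
      (scaleCount n δ * (scaleSteps n k + 1) + 1)))) : ℕ) : ℝ) ≤
      60 * k * (2 + 3 * k / Real.log (1 + δ)) * (n : ℝ) ^ (2 + 1 / (k : ℝ)) := by
  have hn0 : (0 : ℝ) < n := by exact_mod_cast hn
  have hn1 : (1 : ℝ) ≤ n := by exact_mod_cast hn
  have hk1 : (1 : ℝ) ≤ k := by exact_mod_cast hk
  have hlog : 0 < Real.log (1 + δ) := Real.log_pos (by linarith)
  have hN1 : (1 : ℝ) ≤ (n : ℝ) ^ (1 / (k : ℝ)) := Real.one_le_rpow hn1 (by positivity)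
  have hcount : (scaleCount n δ : ℝ) ≤
      (1 + 3 * k / Real.log (1 + δ)) * (n : ℝ) ^ (1 / (k : ℝ)) := by
    have h1 : (scaleCount n δ : ℝ) < 3 * Real.log n / Real.log (1 + δ) + 1 :=
      Nat.ceil_lt_add_one (by have := Real.log_nonneg hn1; positivity)
    -- The logarithmic number of scales is absorbed by the factor n^{1/k} allowed in the running
    -- time.
    have h2 : Real.log n ≤ k * (n : ℝ) ^ (1 / (k : ℝ)) := by
      have := Real.log_le_rpow_div hn0.le (ε := 1 / (k : ℝ)) (by positivity)
      rw [div_div_eq_mul_div, div_one] at this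
      linarith
    have h3 : 3 * Real.log n / Real.log (1 + δ) ≤
        3 * k / Real.log (1 + δ) * (n : ℝ) ^ (1 / (k : ℝ)) := by
      rw [div_mul_eq_mul_div]
      exact div_le_div_of_nonneg_right (by linarith) hlog.le
    linarith
  have hpow : (n : ℝ) ^ (2 + 1 / (k : ℝ)) = (n : ℝ) ^ 2 * (n : ℝ) ^ (1 / (k : ℝ)) := by
    rw [Real.rpow_add hn0, Real.rpow_two]
  have hnn : (n : ℝ) ≤ (n : ℝ) ^ 2 := by nlinarith
  have hkn : (n : ℝ) ^ 2 ≤ k * (n : ℝ) ^ 2 := le_mul_of_one_le_left (by positivity) hk1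
  have hkn' : (k : ℝ) * n ≤ k * (n : ℝ) ^ 2 := by gcongr
  have hscale : ((scaleSteps n k + 1 : ℕ) : ℝ) ≤ 60 * k * (n : ℝ) ^ 2 := by
    unfold scaleSteps
    push_cast
    nlinarith
  have hbase : (n : ℝ) * 3 + 2 + (1 + (1 + (n * (n * 4 + 4) + 2 + 1))) ≤
      60 * k * (n : ℝ) ^ 2 := by
    nlinarith
  have hmul := mul_le_mul hcount hscale (by positivity) (by positivity)
  have hbase' : 60 * k * (n : ℝ) ^ 2 ≤ 60 * k * (n : ℝ) ^ 2 * (n : ℝ) ^ (1 / (k : ℝ)) :=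
    le_mul_of_one_le_right (by positivity) hN1
  push_cast at hmul ⊢
  rw [hpow]
  linarith

theorem exists_exec_spannerProg {k : ℕ} {ε : ℝ} (hk : 0 < k) (hε : 0 < ε) :
    ∃ C : ℝ, 0 < C ∧ ∀ (n : ℕ) (D : ℕ → ℕ → ℝ), 0 < n → IsMetric D n →
      ∃ (c : ℕ) (s : State), Exec D spannerProg (initState n k ε) c s ∧
        (c : ℝ) ≤ C * (n : ℝ) ^ (2 + 1 / (k : ℝ)) ∧
        (∀ u < n, ∀ v < n, Reach D n s.out u v ((2 * k - 1) * (1 + ε) * D u v)) ∧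
        ∀ X, Pack D n X → listWeight D s.out ≤ C * (n : ℝ) ^ (1 / (k : ℝ)) * X := by
  obtain ⟨δ, hδe⟩ : ∃ δ, δ = ε / (5 + 5 * ε) := ⟨_, rfl⟩
  have hδ : 0 < δ := by rw [hδe]; positivity
  have hlog : 0 < Real.log (1 + δ) := Real.log_pos (by linarith)
  have hk0 : (0 : ℝ) < k := by exact_mod_cast hk
  obtain ⟨A, hA⟩ : ∃ A, A = 60 * k * (2 + 3 * k / Real.log (1 + δ)) := ⟨_, rfl⟩
  obtain ⟨P, hP⟩ : ∃ P, P = (1 + δ) / δ + 1 / (1 - (1 + δ) ^ (-(1 / (k : ℝ)))) := ⟨_, rfl⟩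
  have hA0 : 0 < A := by rw [hA]; positivity
  have hP0 : 0 < P := by
    have := sub_pos.2 (rpow_neg_lt_one (θ := 1 / (k : ℝ)) (by positivity) hδ)
    rw [hP]
    positivity
  -- One constant serves both purposes: A bounds the steps, and the other summand bounds the weight,
  -- with P the supremum bound on the potential.
  refine ⟨A + (1 + (2 * k + 1) * (4 / (δ * δ) * P)), by positivity, fun n D hn hD => ?_⟩
  have hn1 : (1 : ℝ) ≤ n := by exact_mod_cast hn
  have hN1 : (1 : ℝ) ≤ (n : ℝ) ^ (1 / (k : ℝ)) := Real.one_le_rpow hn1 (by positivity)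
  obtain ⟨c, y, hex, hc, hreach, hwt⟩ := runs_spannerProg hD hn hk hε hδe
  rw [Vars.start_toState] at hex
  refine ⟨c, y.toState, hex, ?_, hreach, fun X hX => ?_⟩
  · refine ((Nat.cast_le.2 hc).trans (steps_le hn hk hδ)).trans ?_
    rw [← hA]
    gcongr
    exact le_add_of_nonneg_right (by positivity)
  · have h := hwt X hX
    rw [← hP] at h
    have hX0 := hX.nonneg
    have h1 : X ≤ (n : ℝ) ^ (1 / (k : ℝ)) * X := le_mul_of_one_le_left hX0 hN1
    have h2 : 0 ≤ A * ((n : ℝ) ^ (1 / (k : ℝ)) * X) := by positivity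
    refine h.trans ?_
    linarith

end SubsetSpanner

/-! ### From finite metrics back to the graph -/

theorem mainTheorem1 :
    ∃ P : SubsetSpanner.Prog, ∀ (k : ℕ) (ε : ℝ), 0 < k → 0 < ε → ∃ C : ℝ, 0 < C ∧
      ∀ (V : Type*) [Finite V] (G : SimpleGraph V) (w : Sym2 V → NNReal) (T : Finset V)
        (τ : Fin T.card ≃ T),
        G.Connected → (∀ e ∈ G.edgeSet, 0 < w e) → T.Nonempty →
        ∃ (c : ℕ) (s : SubsetSpanner.State),
          SubsetSpanner.Exec (SubsetSpanner.closureMatrix G w T τ) P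
            (SubsetSpanner.initState T.card k ε) c s ∧
          (c : ℝ) ≤ C * (T.card : ℝ) ^ (2 + 1 / (k : ℝ)) ∧
          SubsetSpanner.IsSubsetwiseSpanner ⊤ (SubsetSpanner.closureWeight G w T) Set.univ
            ((2 * k - 1) * (1 + ε)) (SubsetSpanner.closureSpanner T τ s.out) ∧
          ∀ R : Sym2 T → Set (Sym2 V), SubsetSpanner.IsShortestPathChoice G w T R →
            SubsetSpanner.IsSubsetwiseSpanner G w T ((2 * k - 1) * (1 + ε))
              (SubsetSpanner.expand G T R (SubsetSpanner.closureSpanner T τ s.out)) ∧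
            (SubsetSpanner.edgeWeight w
                (SubsetSpanner.expand G T R
                  (SubsetSpanner.closureSpanner T τ s.out)).edgeSet : ℝ) ≤
              C * (T.card : ℝ) ^ (1 / (k : ℝ)) *
                SubsetSpanner.optWeight G w T ((2 * k - 1) * (1 + ε)) ∧
            (SubsetSpanner.edgeWeight w
                (SubsetSpanner.expand G T R
                  (SubsetSpanner.closureSpanner T τ s.out)).edgeSet : ℝ) ≤
              C * (T.card : ℝ) ^ (1 / (k : ℝ)) * SubsetSpanner.steinerWeight G w T := by
  refine ⟨SubsetSpanner.spannerProg, fun k ε hk hε => ?_⟩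
  obtain ⟨C, hC, h⟩ := SubsetSpanner.exists_exec_spannerProg hk hε
  refine ⟨C, hC, fun V _ G w T τ hG _ hT => ?_⟩
  have hD := SubsetSpanner.isMetric_closureMatrix hG w T τ
  have hT0 : 0 < T.card := Finset.card_pos.2 hT
  have hk1 : (1 : ℝ) ≤ k := by exact_mod_cast hk
  have ht : (1 : ℝ) ≤ (2 * k - 1) * (1 + ε) := by nlinarith
  obtain ⟨c, s, hex, hc, hreach, hwt⟩ := h T.card _ hT0 hD
  have hspan : ∀ u v : T, SubsetSpanner.wdist (SubsetSpanner.closureSpanner T τ s.out).spanningCoe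
      (SubsetSpanner.closureWeight G w T) u v ≤
      ENNReal.ofReal ((2 * k - 1) * (1 + ε)) * SubsetSpanner.wdist G w u v := by
    intro u v
    obtain ⟨i, rfl⟩ := τ.surjective u
    obtain ⟨j, rfl⟩ := τ.surjective v
    refine (SubsetSpanner.wdist_closureSpanner_le hG w T τ
      (hreach i i.2 j j.2) i.2 j.2).2.trans ?_
    rw [ENNReal.ofReal_mul (by linarith), SubsetSpanner.closureMatrix_apply,
      ENNReal.ofReal_toReal (SubsetSpanner.wdist_ne_top hG w _ _)]
  have hA : 0 < C * (T.card : ℝ) ^ (1 / (k : ℝ)) := by positivity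
  refine ⟨c, s, hex, hc, ⟨Set.subset_union_left, fun u _ v _ => (hspan u v).trans ?_⟩,
    fun R hR => ⟨⟨Set.subset_union_left, fun u hu v hv => ?_⟩, ?_, ?_⟩⟩
  · gcongr
    exact SubsetSpanner.wdist_le_wdist_closure hG w T u v
  · exact (SubsetSpanner.wdist_expand_le hG w T hR _ ⟨u, hu⟩ ⟨v, hv⟩).trans
      (hspan ⟨u, hu⟩ ⟨v, hv⟩)
  · exact SubsetSpanner.le_mul_optWeight hG w T τ ht hA fun X hX =>
      (SubsetSpanner.edgeWeight_expand_le hG w T τ hR s.out).trans (hwt X hX)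
  · exact SubsetSpanner.le_mul_steinerWeight hG w T τ hA fun X hX =>
      (SubsetSpanner.edgeWeight_expand_le hG w T τ hR s.out).trans (hwt X hX)
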